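/- Fix constants $D,\chi,T>0$ and $\lambda\in\mathbb R$. Write $\mathcal S(\mathbb R)$ for the real Schwartz space, $\mathcal S'(\mathbb R)$ for its dual with the strong topology, $\mathcal E(u)=\int_{\mathbb R}u'(x)^2\,dx$, and $i_\varepsilon(x;y)=\varepsilon^{-1}\mathbf 1_{\{x<y\le x+\varepsilon\}}$ for $\varepsilon>0$. Let $\{\mathcal Y_t;\,t\in[0,T]\}$ be a jointly measurable $\mathcal S'(\mathbb R)$-valued stochastic process (that is, $(t,\omega)\mapsto\mathcal Y_t(\omega)(u)$ is measurable for each $u\in\mathcal S(\mathbb R)$) that is a stationary energy solution of the stochastic Burgers equation $$d\mathcal Y_t=D\,\Delta\mathcal Y_t\,dt+\lambda\,\nabla\mathcal Y_t^2\,dt+\sqrt{2\chi D}\,\nabla d\mathcal B_t .$$ This means the following. (S) For each $t\in[0,T]$, $\mathcal Y_t$ is a white noise of variance $\chi$: for every $u\in\mathcal S(\mathbb R)$, $\mathcal Y_t(u)$ is Gaussian with mean $0$ and variance $\chi\int_{\mathbb R}u(x)^2\,dx$. Consequently $\mathcal Y_t(f)$ is defined for $f\in L^2(\mathbb R)$,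 as the limit in $L^2(P)$ of $\mathcal Y_t(u_n)$ for test functions $u_n\to f$ in $L^2(\mathbb R)$. For $\varepsilon>0$ and $0\le s\le t\le T$ put $$\mathcal A^{\varepsilon}_{s,t}(u)=\int_s^t\int_{\mathbb R}\mathcal Y_r(i_\varepsilon(x))^2\,u'(x)\,dx\,dr ,$$ where a version of $\mathcal Y_r(i_\varepsilon(x))$ that is jointly measurable in $(r,x,\omega)$ is used. (EC) There is a constant $\kappa>0$ such that for all $u\in\mathcal S(\mathbb R)$, all $0\le s<t\le T$ and all $0<\delta<\varepsilon<1$, $$\mathbb E\Big[\Big(\int_s^t\mathcal Y_r(\Delta u)\,dr\Big)^2\Big]\le\kappa(t-s)\,\mathcal E(u),\qquad \mathbb E\big[\big(\mathcal A^{\varepsilon}_{s,t}(u)-\mathcal A^{\delta}_{s,t}(u)\big)^2\big]\le\kappa(t-s)\,\varepsilon\,\mathcal E(u).$$ (M) There is an $\mathcal S'(\mathbb R)$-valued process $\{\mathcal A_t;\,t\in[0,T]\}$ with almost surely continuous paths, satisfying $\mathcal A_t(u)=\lim_{\varepsilon\to0}\mathcal A^{\varepsilon}_{0,t}(u)$ in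 $L^2(P)$ for all $t\in[0,T]$ and $u\in\mathcal S(\mathbb R)$, such that for every $u\in\mathcal S(\mathbb R)$ the process $$\mathcal M_t(u)=\mathcal Y_t(u)-\mathcal Y_0(u)-D\int_0^t\mathcal Y_s(\Delta u)\,ds-\lambda\mathcal A_t(u),\qquad t\in[0,T],$$ is a continuous martingale of quadratic variation $2\chi D\,t\,\mathcal E(u)$, that is, $\mathcal M_t(u)$ and $\mathcal M_t(u)^2-2\chi D\,t\,\mathcal E(u)$ are martingales (with respect to a common filtration, which may depend on $u$) and $t\mapsto\mathcal M_t(u)$ is almost surely continuous. Then, for every $u\in\mathcal S(\mathbb R)$, almost surely, the path $t\mapsto\mathcal Y_t(u)$ is Hölder continuous of index $\alpha$ on $[0,T]$ for every $\alpha\in(0,\tfrac14)$. -/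

import Mathlib

open MeasureTheory ProbabilityTheory Set Filter Topology
open scoped SchwartzMap NNReal ENNReal

noncomputable section

namespace StochasticBurgers

/-- The space `𝓢'(ℝ)` of real tempered distributions: the topological dual of `𝓢(ℝ)`. The topology
that Mathlib puts on this type (uniform convergence on bounded sets) is the strong topology. -/
abbrev TempDist : Type := 𝓢(ℝ, ℝ) →L[ℝ] ℝ

/-- The second derivative `Δ u` of a test function, as a test function. -/
def lap (u : 𝓢(ℝ, ℝ)) : 𝓢(ℝ, ℝ) :=
  SchwartzMap.derivCLM ℝ ℝ (SchwartzMap.derivCLM ℝ ℝ u)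

/-- The energy `𝓔(u) = ⟨∇u, ∇u⟩`. -/
def energy (u : 𝓢(ℝ, ℝ)) : ℝ := ∫ x, deriv u x ^ 2

/-- The approximate identity `i_ε(x; y) = ε⁻¹ 1_{x < y ≤ x + ε}`, as a function of `y`. -/
def approxId (ε x : ℝ) : ℝ → ℝ := (Ioc x (x + ε)).indicator (fun _ => ε⁻¹)

variable {Ω : Type*} [MeasurableSpace Ω]

/-! Processes indexed by `[0, T]` are written as functions of `t : ℝ`; their values for
`t ∉ [0, T]` are never used. -/

/-- `Y` is an `𝓢'(ℝ)`-valued process on `[0, T]`: each `Y_t` is a random variable. -/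
def IsProcess (T : ℝ) (Y : ℝ → Ω → TempDist) : Prop :=
  ∀ t ∈ Icc 0 T, ∀ u : 𝓢(ℝ, ℝ), Measurable (fun ω => Y t ω u)

/-- `Y` is a (jointly) measurable `𝓢'(ℝ)`-valued process on `[0, T]`, so that time integrals of
`Y_t(u)` make sense. Every process with continuous trajectories has this property. -/
def IsMeasurableProcess (T : ℝ) (Y : ℝ → Ω → TempDist) : Prop :=
  ∀ u : 𝓢(ℝ, ℝ), Measurable (fun p : Icc (0 : ℝ) T × Ω => Y p.1 p.2 u)

/-- `W` is a white noise of mean zero and variance `χ`. -/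
def IsWhiteNoise (P : Measure Ω) (χ : ℝ) (W : Ω → TempDist) : Prop :=
  ∀ u : 𝓢(ℝ, ℝ), HasLaw (fun ω => W ω u) (gaussianReal 0 (χ * ∫ x, u x ^ 2).toNNReal) P

/-- Stationarity: at each fixed time, `Y_t` is a white noise of variance `χ`. -/
def IsStationary (P : Measure Ω) (χ T : ℝ) (Y : ℝ → Ω → TempDist) : Prop :=
  ∀ t ∈ Icc 0 T, IsWhiteNoise P χ (Y t)

/-- The random variable `X` is (a version of) `W(f)`, where `f ∈ L²(ℝ)` need not be a test
function: `W(uₙ) → X` in `L²(P)` whenever the test functions `uₙ` converge to `f` in `L²(ℝ)`.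
If `W` is a white noise, such an `X` exists and is unique up to almost sure equality. -/
def IsL2Value (P : Measure Ω) (W : Ω → TempDist) (f : ℝ → ℝ) (X : Ω → ℝ) : Prop :=
  ∀ u : ℕ → 𝓢(ℝ, ℝ),
    Tendsto (fun n => eLpNorm (fun y => u n y - f y) 2 volume) atTop (𝓝 0) →
    Tendsto (fun n => eLpNorm (fun ω => W ω (u n) - X ω) 2 P) atTop (𝓝 0)

/-- `Z ε r x` is `Y_r(i_ε(x))` for all `ε > 0`, `r ∈ [0, T]`, `x ∈ ℝ`, in a version that is jointly
measurable in `(r, x, ω)`. By Fubini's theorem the integrals below do not depend, up to almost sure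
equality, on the version. -/
structure IsAveragedField (P : Measure Ω) (T : ℝ) (Y : ℝ → Ω → TempDist)
    (Z : ℝ → ℝ → ℝ → Ω → ℝ) : Prop where
  measurable : ∀ ε : ℝ, 0 < ε →
    Measurable (fun p : Icc (0 : ℝ) T × ℝ × Ω => Z ε p.1 p.2.1 p.2.2)
  isL2Value : ∀ ε : ℝ, 0 < ε → ∀ r ∈ Icc 0 T, ∀ x : ℝ,
    IsL2Value P (Y r) (approxId ε x) (Z ε r x)

/-- `𝓐^ε_{s,t}(u) = ∫ₛᵗ ∫ Y_r(i_ε(x))² ∇u(x) dx dr`, where `Z ε r x = Y_r(i_ε(x))`. -/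
def quadInt (Z : ℝ → ℝ → ℝ → Ω → ℝ) (ε s t : ℝ) (u : 𝓢(ℝ, ℝ)) (ω : Ω) : ℝ :=
  ∫ r in s..t, ∫ x, Z ε r x ω ^ 2 * deriv u x

/-- The energy estimate. The expectations are `[0, ∞]`-valued, so that a bound on them includes
their finiteness. -/
def EnergyEstimate (P : Measure Ω) (T : ℝ) (Y : ℝ → Ω → TempDist)
    (Z : ℝ → ℝ → ℝ → Ω → ℝ) : Prop :=
  ∃ κ : ℝ, 0 < κ ∧
    (∀ u : 𝓢(ℝ, ℝ), ∀ s ∈ Icc 0 T, ∀ t ∈ Icc 0 T, s < t →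
      ∫⁻ ω, ENNReal.ofReal ((∫ r in s..t, Y r ω (lap u)) ^ 2) ∂P
        ≤ ENNReal.ofReal (κ * (t - s) * energy u)) ∧
    (∀ u : 𝓢(ℝ, ℝ), ∀ δ ε : ℝ, 0 < δ → δ < ε → ε < 1 →
      ∀ s ∈ Icc 0 T, ∀ t ∈ Icc 0 T, s < t →
      ∫⁻ ω, ENNReal.ofReal ((quadInt Z ε s t u ω - quadInt Z δ s t u ω) ^ 2) ∂P
        ≤ ENNReal.ofReal (κ * (t - s) * ε * energy u))

/-- `A` is the nonlinear term: an `𝓢'(ℝ)`-valued process with continuous paths such that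
`A_t(u) = lim_{ε → 0} 𝓐^ε_{0,t}(u)` in `L²(P)` for all `t ∈ [0, T]` and all `u`. -/
structure IsNonlinearTerm (P : Measure Ω) (T : ℝ) (Z : ℝ → ℝ → ℝ → Ω → ℝ)
    (A : ℝ → Ω → TempDist) : Prop where
  isProcess : IsProcess T A
  continuous : ∀ᵐ ω ∂P, ContinuousOn (fun t => A t ω) (Icc 0 T)
  tendsto : ∀ u : 𝓢(ℝ, ℝ), ∀ t ∈ Icc 0 T,
    Tendsto (fun ε => eLpNorm (fun ω => quadInt Z ε 0 t u ω - A t ω u) 2 P) (𝓝[>] 0) (𝓝 0)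

/-- The real process `M` is a continuous martingale on `[0, T]` (in some filtration, hence in its
own) whose quadratic variation is the deterministic function `Q`, that is, `M² - Q` is a
martingale as well. It is meant for continuous nondecreasing `Q` with `Q 0 = 0`. -/
def IsContMartingaleWithQV (P : Measure Ω) (T : ℝ) (M : ℝ → Ω → ℝ) (Q : ℝ → ℝ) : Prop :=
  ∃ ℱ : Filtration (Icc (0 : ℝ) T) (inferInstance : MeasurableSpace Ω),
    Martingale (fun t : Icc (0 : ℝ) T => M t) ℱ P ∧
    (∀ᵐ ω ∂P, ContinuousOn (fun t => M t ω) (Icc 0 T)) ∧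
    Martingale (fun (t : Icc (0 : ℝ) T) ω => M t ω ^ 2 - Q t) ℱ P

/-- `Y` is a stationary energy solution on `[0, T]` of the stochastic Burgers equation
`dY_t = D ΔY_t dt + lam ∇Y_t² dt + √(2χD) ∇dB_t`. -/
structure IsStationaryEnergySolution (P : Measure Ω) (D χ lam T : ℝ)
    (Y : ℝ → Ω → TempDist) : Prop where
  isMeasurableProcess : IsMeasurableProcess T Y
  isStationary : IsStationary P χ T Y
  exists_fields : ∃ (Z : ℝ → ℝ → ℝ → Ω → ℝ) (A : ℝ → Ω → TempDist),
    IsAveragedField P T Y Z ∧ EnergyEstimate P T Y Z ∧ IsNonlinearTerm P T Z A ∧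
    ∀ u : 𝓢(ℝ, ℝ), IsContMartingaleWithQV P T
      (fun t ω => Y t ω u - Y 0 ω u - D * (∫ s in (0 : ℝ)..t, Y s ω (lap u)) - lam * A t ω u)
      (fun t => 2 * χ * D * t * energy u)

end StochasticBurgers

end

/-! By the martingale decomposition, `Y_t(u)` is the sum of `Y_0(u)`, a drift, the nonlinear term
and a martingale. Kolmogorov's criterion is applied to each of the last three, all of which have
continuous paths.

Drift: Cauchy–Schwarz in time and stationarity bound the second moment of an increment by a multiple
of `(t - s)²`, which gives every index below 1/2.

Martingale: the quadratic variation is linear in time, so the fourth moment of an increment is of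
order `(t - s)²`, which gives every index below 1/4. This moment bound
(`IsContMartingaleWithQV.lintegral_pow_four_le`) comes from a discrete Itô expansion of the fourth
power along fine partitions, truncated because fourth moments are not known to be finite in advance.

Nonlinear term: at a fixed scale `ε`, Wick's formula for white noise and `∫ u' = 0` bound the second
moment of `∫ Y_r(i_ε(x))² u'(x) dx` by `C / ε`, so the time integral over `[s, t]` has second moment
at most `C (t - s)² / ε`. By the energy estimate, replacing the scale `ε` by its limit costs at most
`κ (t - s) ε 𝓔(u)`. With `ε` of order `√(t - s)` both bounds are of order `(t - s)^(3/2)`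
(`IsNonlinearTerm.exists_lintegral_sq_sub_le`), which again gives every index below 1/4. -/

/-! ### Kolmogorov's criterion by dyadic chaining. -/

theorem floor_two_mul (x : ℝ) (hx : 0 ≤ x) :
    ⌊2 * x⌋₊ = 2 * ⌊x⌋₊ ∨ ⌊2 * x⌋₊ = 2 * ⌊x⌋₊ + 1 := by
  have h1 := Nat.floor_le hx
  have h2 := Nat.lt_floor_add_one x
  have h3 : 2 * ⌊x⌋₊ ≤ ⌊2 * x⌋₊ := Nat.le_floor (by push_cast; linarith)
  have h4 : ⌊2 * x⌋₊ < 2 * ⌊x⌋₊ + 2 := by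
    rw [Nat.floor_lt (by linarith)]; push_cast; linarith
  omega

/-- A continuous function on `[0, 1]` whose dyadic increments of level `n` are bounded by `C q ^ n`
is close to its values at the dyadic approximations from below. -/
theorem dist_dyadic_le {f : ℝ → ℝ} (hf : ContinuousOn f (Icc 0 1)) {C q : ℝ} (hC : 0 ≤ C)
    (hq0 : 0 < q) (hq1 : q < 1)
    (h : ∀ n i : ℕ, i < 2 ^ n → |f ((i + 1) / 2 ^ n) - f (i / 2 ^ n)| ≤ C * q ^ n)
    (n : ℕ) {t : ℝ} (ht : t ∈ Icc (0 : ℝ) 1) :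
    dist (f (⌊t * 2 ^ n⌋₊ / 2 ^ n)) (f t) ≤ C * q ^ n / (1 - q) := by
  set u : ℕ → ℝ := fun m => f (⌊t * 2 ^ (n + m)⌋₊ / 2 ^ (n + m)) with hu
  have hmem : ∀ m : ℕ, (⌊t * 2 ^ m⌋₊ : ℝ) / 2 ^ m ∈ Icc (0 : ℝ) 1 := fun m => by
    refine ⟨by positivity, (div_le_one (by positivity)).2 ?_⟩
    exact (Nat.floor_le (mul_nonneg ht.1 (by positivity))).trans
      (mul_le_of_le_one_left (by positivity) ht.2)
  have hlim : Tendsto (fun m : ℕ => (⌊t * 2 ^ m⌋₊ : ℝ) / 2 ^ m) atTop (𝓝 t) :=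
    (tendsto_nat_floor_mul_div_atTop ht.1).comp
      (tendsto_pow_atTop_atTop_of_one_lt (r := (2 : ℝ)) (by norm_num))
  have hu_lim : Tendsto u atTop (𝓝 (f t)) := by
    have : Tendsto (fun m : ℕ => f ((⌊t * 2 ^ m⌋₊ : ℝ) / 2 ^ m)) atTop (𝓝 (f t)) :=
      (hf t ht).tendsto.comp
        (tendsto_nhdsWithin_iff.2 ⟨hlim, Eventually.of_forall hmem⟩)
    exact this.comp (tendsto_atTop_mono (fun m => Nat.le_add_left m n) tendsto_id)
  have hstep : ∀ m, dist (u m) (u (m + 1)) ≤ C * q ^ n * q ^ m := fun m => by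
    have hx : 0 ≤ t * 2 ^ (n + m) := mul_nonneg ht.1 (by positivity)
    have e : t * 2 ^ (n + (m + 1)) = 2 * (t * 2 ^ (n + m)) := by ring
    have hC' : 0 ≤ C * q ^ n * q ^ m := by positivity
    simp only [hu]
    rw [e]
    set k := ⌊t * 2 ^ (n + m)⌋₊ with hk
    have e2 : ((2 * k : ℕ) : ℝ) / 2 ^ (n + (m + 1)) = k / 2 ^ (n + m) := by
      rw [← add_assoc, pow_succ]; push_cast; field_simp
    -- Passing to the next level either keeps the dyadic point or moves it one finer step to the
    -- right.
    rcases floor_two_mul _ hx with h2 | h2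
    · rw [h2, ← hk, e2, dist_self]; exact hC'
    · have hlt : 2 * k < 2 ^ (n + (m + 1)) := by
        have : ⌊2 * (t * 2 ^ (n + m))⌋₊ ≤ 2 ^ (n + (m + 1)) := by
          rw [← e]
          refine Nat.floor_le_of_le ?_
          push_cast
          exact mul_le_of_le_one_left (by positivity) ht.2
        omega
      have := h _ _ hlt
      rw [e2] at this
      rw [h2, ← hk, dist_comm, Real.dist_eq]
      push_cast at this ⊢
      refine this.trans ?_
      rw [show C * q ^ (n + (m + 1)) = C * q ^ n * q ^ m * q by ring]
      exact mul_le_of_le_one_right hC' hq1.le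
  simpa [hu] using dist_le_of_le_geometric_of_tendsto₀ q (C * q ^ n) hq1 hstep hu_lim

/-- Chaining: at the level `n` with `2^(-(n+1)) < t - s ≤ 2^(-n)` the dyadic points below `s` and
`t` coincide or are neighbours. The path from `s` to `t` through them costs three terms of order `q
^ n`, and `q ^ n` is comparable to `(t - s) ^ α`. -/
theorem holderOnWith_Icc_of_dyadic_unit {f : ℝ → ℝ} (hf : ContinuousOn f (Icc 0 1)) {C : ℝ}
    (hC : 0 ≤ C) {α : ℝ≥0} (hα : 0 < α)
    (h : ∀ n i : ℕ, i < 2 ^ n →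
      |f ((i + 1) / 2 ^ n) - f (i / 2 ^ n)| ≤ C * ((2 : ℝ) ^ (-(α : ℝ))) ^ n) :
    ∃ C' : ℝ≥0, HolderOnWith C' α f (Icc 0 1) := by
  set q : ℝ := (2 : ℝ) ^ (-(α : ℝ)) with hq
  have hα' : (0 : ℝ) < α := hα
  have hq0 : 0 < q := by positivity
  have hq1 : q < 1 := Real.rpow_lt_one_of_one_lt_of_neg (by norm_num) (by linarith)
  have h1q : 0 < 1 - q := by linarith
  set B : ℝ := C * (1 + 2 / (1 - q)) * 2 ^ (α : ℝ) with hB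
  have hB0 : 0 ≤ B := by positivity
  have key : ∀ s ∈ Icc (0 : ℝ) 1, ∀ t ∈ Icc (0 : ℝ) 1, s < t →
      dist (f s) (f t) ≤ B * (t - s) ^ (α : ℝ) := by
    intro s hs t ht hst
    obtain ⟨n, hn1, hn2⟩ := exists_nat_pow_near_of_lt_one (x := t - s) (y := (1 / 2 : ℝ))
      (by linarith) (by linarith [hs.1, ht.2]) (by norm_num) (by norm_num)
    have h2n : (0 : ℝ) < 2 ^ n := by positivity
    have hqn : q ^ n ≤ 2 ^ (α : ℝ) * (t - s) ^ (α : ℝ) := by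
      rw [← Real.mul_rpow (by norm_num) (by linarith), hq, ← Real.rpow_natCast,
        ← Real.rpow_mul (by norm_num), mul_comm, Real.rpow_mul (by norm_num)]
      have e0 : ((2 : ℝ) ^ (n : ℝ)) ^ (-(α : ℝ)) = ((1 / 2 : ℝ) ^ n) ^ (α : ℝ) := by
        rw [Real.rpow_neg (by positivity), ← Real.inv_rpow (by positivity), Real.rpow_natCast]
        simp
      rw [e0]
      refine Real.rpow_le_rpow (by positivity) ?_ hα'.le
      rw [pow_succ] at hn1
      linarith
    have hmid : dist (f (⌊s * 2 ^ n⌋₊ / 2 ^ n)) (f (⌊t * 2 ^ n⌋₊ / 2 ^ n)) ≤ C * q ^ n := by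
      have h1 : ⌊s * 2 ^ n⌋₊ ≤ ⌊t * 2 ^ n⌋₊ := Nat.floor_mono (by gcongr)
      have hts : t * 2 ^ n ≤ s * 2 ^ n + 1 := by
        have : (t - s) * 2 ^ n ≤ (1 / 2) ^ n * 2 ^ n := by gcongr
        rw [← mul_pow] at this
        norm_num at this
        linarith
      have h2 : ⌊t * 2 ^ n⌋₊ ≤ ⌊s * 2 ^ n⌋₊ + 1 := by
        rw [← Nat.floor_add_one (mul_nonneg hs.1 h2n.le)]
        exact Nat.floor_mono hts
      rcases h1.eq_or_lt with h3 | h3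
      · rw [h3, dist_self]; positivity
      · have h4 : ⌊t * 2 ^ n⌋₊ = ⌊s * 2 ^ n⌋₊ + 1 := by omega
        have h5 : ⌊t * 2 ^ n⌋₊ ≤ 2 ^ n := by
          refine Nat.floor_le_of_le ?_
          push_cast
          exact mul_le_of_le_one_left h2n.le ht.2
        have := h n ⌊s * 2 ^ n⌋₊ (by omega)
        rw [h4, dist_comm, Real.dist_eq]
        push_cast
        exact this
    have ha := dist_dyadic_le hf hC hq0 hq1 h n hs
    have hb := dist_dyadic_le hf hC hq0 hq1 h n ht
    calc dist (f s) (f t) ≤ dist (f s) (f (⌊s * 2 ^ n⌋₊ / 2 ^ n))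
          + dist (f (⌊s * 2 ^ n⌋₊ / 2 ^ n)) (f (⌊t * 2 ^ n⌋₊ / 2 ^ n))
          + dist (f (⌊t * 2 ^ n⌋₊ / 2 ^ n)) (f t) := dist_triangle4 _ _ _ _
      _ ≤ C * q ^ n / (1 - q) + C * q ^ n + C * q ^ n / (1 - q) := by
          rw [dist_comm (f s)]; gcongr
      _ = C * (1 + 2 / (1 - q)) * q ^ n := by ring
      _ ≤ C * (1 + 2 / (1 - q)) * (2 ^ (α : ℝ) * (t - s) ^ (α : ℝ)) := by gcongr
      _ = B * (t - s) ^ (α : ℝ) := by rw [hB]; ring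
  refine ⟨B.toNNReal, fun s hs t ht => ?_⟩
  have main : dist (f s) (f t) ≤ B * dist s t ^ (α : ℝ) := by
    rcases lt_trichotomy s t with hst | hst | hst
    · rw [dist_comm s, Real.dist_eq t, abs_of_pos (by linarith)]; exact key s hs t ht hst
    · simp only [hst, dist_self]; positivity
    · rw [dist_comm, Real.dist_eq s, abs_of_pos (by linarith)]; exact key t ht s hs hst
  rw [edist_dist, edist_dist, ENNReal.ofReal_rpow_of_nonneg dist_nonneg hα'.le]
  refine (ENNReal.ofReal_le_ofReal main).trans_eq ?_
  rw [ENNReal.ofReal_mul hB0]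
  rfl

/-- A continuous function on `[0, T]` with geometrically small dyadic increments is Hölder. -/
theorem holderOnWith_Icc_of_dyadic {T : ℝ} (hT : 0 < T) {f : ℝ → ℝ}
    (hf : ContinuousOn f (Icc 0 T)) {C : ℝ} (hC : 0 ≤ C) {α : ℝ≥0} (hα : 0 < α)
    (h : ∀ n i : ℕ, i < 2 ^ n →
      |f (T * ((i + 1) / 2 ^ n)) - f (T * (i / 2 ^ n))| ≤ C * ((2 : ℝ) ^ (-(α : ℝ))) ^ n) :
    ∃ C' : ℝ≥0, HolderOnWith C' α f (Icc 0 T) := by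
  have hmaps : MapsTo (fun x => T * x) (Icc 0 1) (Icc 0 T) := fun x hx =>
    ⟨mul_nonneg hT.le hx.1, mul_le_of_le_one_right hT.le hx.2⟩
  obtain ⟨C', hC'⟩ := holderOnWith_Icc_of_dyadic_unit (f := fun x => f (T * x))
    (hf.comp (by fun_prop) hmaps) hC hα h
  have hL : HolderWith (T⁻¹).toNNReal 1 (fun x : ℝ => T⁻¹ * x) := by
    rw [holderWith_one]
    refine LipschitzWith.of_dist_le_mul fun x y => ?_
    rw [Real.dist_eq, Real.dist_eq, ← mul_sub, abs_mul, abs_of_pos (inv_pos.2 hT),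
      Real.coe_toNNReal _ (inv_pos.2 hT).le]
  have hm2 : MapsTo (fun x => T⁻¹ * x) (Icc 0 T) (Icc 0 1) := fun x hx =>
    ⟨mul_nonneg (inv_pos.2 hT).le hx.1, by
      rw [inv_mul_le_iff₀ hT]; simpa using hx.2⟩
  have := hC'.comp (hL.holderOnWith (Icc 0 T)) hm2
  rw [mul_one] at this
  refine ⟨C' * T⁻¹.toNNReal ^ (α : ℝ), fun x hx y hy => ?_⟩
  have h1 := this x hx y hy
  simp only [Function.comp, mul_inv_cancel_left₀ hT.ne'] at h1
  exact h1

/-- Kolmogorov's criterion: a process with continuous paths and `E |X_t - X_s| ^ p ≤ K (t - s) ^ q`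
has `α`-Hölder paths if `α p < q - 1`. -/
theorem ae_holderOnWith_of_moment_le {Ω : Type*} [MeasurableSpace Ω] {P : Measure Ω} {T : ℝ}
    (hT : 0 < T) {X : ℝ → Ω → ℝ} (hXm : ∀ t ∈ Icc 0 T, AEMeasurable (X t) P)
    (hXc : ∀ᵐ ω ∂P, ContinuousOn (fun t => X t ω) (Icc 0 T)) {p : ℕ} (hp : p ≠ 0) {q K : ℝ}
    (hX : ∀ s ∈ Icc 0 T, ∀ t ∈ Icc 0 T, s < t →
      ∫⁻ ω, ENNReal.ofReal (|X t ω - X s ω| ^ p) ∂P ≤ ENNReal.ofReal (K * (t - s) ^ q))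
    {α : ℝ≥0} (hα : 0 < α) (hαq : α * p < q - 1) :
    ∀ᵐ ω ∂P, ∃ C : ℝ≥0, HolderOnWith C α (fun t => X t ω) (Icc 0 T) := by
  set b : ℝ := (2 : ℝ) ^ (α : ℝ) with hb
  have hb0 : 0 < b := by positivity
  set Δ : ℕ → ℕ → Ω → ℝ := fun n i ω => |X (T * ((i + 1) / 2 ^ n)) ω - X (T * (i / 2 ^ n)) ω|
    with hΔ
  -- One random variable controls all dyadic increments at once. Level `n` has `2 ^ n` increments
  -- and contributes at most a constant times `r ^ n` to the mean, where `r = 2 ^ (α p + 1 - q) <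
  -- 1`.
  set S : Ω → ℝ≥0∞ := fun ω =>
    ∑' n : ℕ, ∑ i ∈ Finset.range (2 ^ n), ENNReal.ofReal ((b ^ n * Δ n i ω) ^ p) with hS
  have hmem : ∀ n i : ℕ, i ≤ 2 ^ n → T * ((i : ℝ) / 2 ^ n) ∈ Icc 0 T := fun n i hi => by
    refine ⟨by positivity, mul_le_of_le_one_right hT.le ((div_le_one (by positivity)).2 ?_)⟩
    exact_mod_cast hi
  have hmem' : ∀ n i : ℕ, i < 2 ^ n → T * (((i : ℝ) + 1) / 2 ^ n) ∈ Icc 0 T := fun n i hi => by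
    have := hmem n (i + 1) hi
    push_cast at this
    exact this
  have hmeas : ∀ n i, i < 2 ^ n → AEMeasurable (Δ n i) P := fun n i hi => by
    have := (hXm _ (hmem' n i hi)).sub (hXm _ (hmem n i hi.le))
    exact this.norm
  set r : ℝ := (b ^ p * 2) * (2 : ℝ) ^ (-q) with hr
  have hr1 : r < 1 := by
    have : r = (2 : ℝ) ^ ((α : ℝ) * p + 1 - q) := by
      rw [hr, hb, ← Real.rpow_natCast, ← Real.rpow_mul (by norm_num),
        sub_eq_add_neg, Real.rpow_add (by norm_num), Real.rpow_add (by norm_num), Real.rpow_one]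
    rw [this]
    exact Real.rpow_lt_one_of_one_lt_of_neg (by norm_num) (by linarith)
  have hr0 : 0 < r := by positivity
  have hterm : ∀ n i, i < 2 ^ n →
      ∫⁻ ω, ENNReal.ofReal ((b ^ n * Δ n i ω) ^ p) ∂P
        ≤ ENNReal.ofReal ((b ^ n) ^ p * (K * T ^ q * ((2 : ℝ) ^ (-q)) ^ n)) := fun n i hi => by
    have h1 : ∀ ω, ENNReal.ofReal ((b ^ n * Δ n i ω) ^ p)
        = ENNReal.ofReal ((b ^ n) ^ p) * ENNReal.ofReal (Δ n i ω ^ p) := fun ω => by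
      rw [mul_pow, ENNReal.ofReal_mul (by positivity)]
    simp_rw [h1]
    rw [lintegral_const_mul'' _ ((hmeas n i hi).pow_const p).ennreal_ofReal,
      ENNReal.ofReal_mul (by positivity)]
    gcongr
    have hlt : T * ((i : ℝ) / 2 ^ n) < T * (((i : ℝ) + 1) / 2 ^ n) := by
      gcongr; linarith
    refine (hX _ (hmem n i hi.le) _ (hmem' n i hi) hlt).trans_eq ?_
    congr 1
    have : T * (((i : ℝ) + 1) / 2 ^ n) - T * ((i : ℝ) / 2 ^ n) = T * (2 ^ n)⁻¹ := by
      field_simp; ring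
    rw [this, Real.mul_rpow hT.le (by positivity), Real.inv_rpow (by positivity),
      ← Real.rpow_neg (by positivity), ← Real.rpow_natCast 2, ← Real.rpow_natCast (2 ^ (-q)),
      ← Real.rpow_mul (by norm_num), ← Real.rpow_mul (by norm_num), mul_comm (n : ℝ), mul_assoc]
  have hSfin : ∫⁻ ω, S ω ∂P ≠ ∞ := by
    have hm : ∀ n, ∀ i ∈ Finset.range (2 ^ n),
        AEMeasurable (fun ω => ENNReal.ofReal ((b ^ n * Δ n i ω) ^ p)) P := fun n i hi =>
      (((hmeas n i (Finset.mem_range.1 hi)).const_mul _).pow_const p).ennreal_ofReal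
    rw [hS, lintegral_tsum fun n => Finset.aemeasurable_fun_sum _ (hm n)]
    have hle : ∀ n, ∫⁻ ω, ∑ i ∈ Finset.range (2 ^ n), ENNReal.ofReal ((b ^ n * Δ n i ω) ^ p) ∂P
        ≤ ENNReal.ofReal (K * T ^ q * r ^ n) := fun n => by
      rw [lintegral_finsetSum' _ (hm n)]
      refine (Finset.sum_le_sum fun i hi => hterm n i (Finset.mem_range.1 hi)).trans ?_
      rw [Finset.sum_const, Finset.card_range, nsmul_eq_mul, ← ENNReal.ofReal_natCast,
        ← ENNReal.ofReal_mul (by positivity)]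
      refine ENNReal.ofReal_le_ofReal (le_of_eq ?_)
      rw [hr, mul_pow, mul_pow, ← pow_mul, ← pow_mul, mul_comm n p]
      push_cast
      ring
    refine ne_top_of_le_ne_top ?_ (ENNReal.tsum_le_tsum hle)
    exact ((summable_geometric_of_lt_one hr0.le hr1).mul_left _).tsum_ofReal_ne_top
  have hSm : AEMeasurable S P := by
    refine AEMeasurable.tsum fun n => Finset.aemeasurable_fun_sum _ fun i hi => ?_
    exact (((hmeas n i (Finset.mem_range.1 hi)).const_mul _).pow_const p).ennreal_ofReal
  filter_upwards [hXc, ae_lt_top' hSm hSfin] with ω hc hω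
  set s : ℝ := (S ω).toReal with hs
  have hs0 : 0 ≤ s := ENNReal.toReal_nonneg
  -- The constant `max 1 s` avoids taking a `p`-th root: a number above 1 is at most its `p`-th
  -- power, hence at most `s`.
  refine holderOnWith_Icc_of_dyadic hT hc (C := max 1 s) (by positivity) hα fun n i hi => ?_
  have h1 : ENNReal.ofReal ((b ^ n * Δ n i ω) ^ p) ≤ S ω :=
    (Finset.single_le_sum (f := fun i => ENNReal.ofReal ((b ^ n * Δ n i ω) ^ p))
      (fun _ _ => zero_le) (Finset.mem_range.2 hi)).trans
      (ENNReal.le_tsum (f := fun n => ∑ i ∈ Finset.range (2 ^ n),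
        ENNReal.ofReal ((b ^ n * Δ n i ω) ^ p)) n)
  have h2 : (b ^ n * Δ n i ω) ^ p ≤ s := (ENNReal.ofReal_le_iff_le_toReal hω.ne).1 h1
  have h3 : b ^ n * Δ n i ω ≤ max 1 s := by
    by_contra! hcon
    have h4 : 1 ≤ b ^ n * Δ n i ω := (le_max_left _ _).trans hcon.le
    have h5 : b ^ n * Δ n i ω ≤ (b ^ n * Δ n i ω) ^ p := le_self_pow₀ h4 hp
    exact absurd ((le_max_right _ _).trans_lt hcon) (not_lt.2 (h5.trans h2))
  have h4 : ((2 : ℝ) ^ (-(α : ℝ))) ^ n = (b ^ n)⁻¹ := by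
    rw [Real.rpow_neg (by norm_num), inv_pow]
  rw [h4, ← div_eq_mul_inv, le_div_iff₀ (by positivity), mul_comm]
  exact h3

/-! ### Gaussian fourth moments and `L²` limits of Gaussian variables. -/

/-- The moment is the fourth derivative at 0 of the moment generating function `exp (v t² / 2)`.
Every derivative is this exponential times a polynomial, and `hP` is the rule that produces the next
polynomial. -/
theorem integral_pow_four_gaussianReal (v : ℝ≥0) :
    ∫ x, x ^ 4 ∂(gaussianReal 0 v) = 3 * (v : ℝ) ^ 2 := by
  have h := iteratedDeriv_mgf_zero (X := fun x : ℝ => x) (μ := gaussianReal 0 v) (by simp) 4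
  have h2 : ∫ x, x ^ 4 ∂(gaussianReal 0 v)
      = iteratedDeriv 4 (mgf (fun x => x) (gaussianReal 0 v)) 0 := by
    rw [h]; rfl
  rw [h2, mgf_fun_id_gaussianReal]
  set w : ℝ := (v : ℝ)
  have hE : ∀ t : ℝ, HasDerivAt (fun t : ℝ => Real.exp (0 * t + w * t ^ 2 / 2))
      (Real.exp (0 * t + w * t ^ 2 / 2) * (w * t)) t := fun t => by
    have : HasDerivAt (fun t : ℝ => 0 * t + w * t ^ 2 / 2) (w * t) t := by
      have h1 := (((hasDerivAt_id t).pow 2).const_mul w).div_const 2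
      have h2 := ((hasDerivAt_id t).const_mul 0).add h1
      convert! h2 using 1
      simp; ring
    exact this.exp
  have hP : ∀ (p p' : ℝ → ℝ), (∀ t, HasDerivAt p (p' t) t) →
      deriv (fun t => Real.exp (0 * t + w * t ^ 2 / 2) * p t)
        = fun t => Real.exp (0 * t + w * t ^ 2 / 2) * (w * t * p t + p' t) := fun p p' hp => by
    funext t
    exact ((hE t).mul (hp t)).deriv.trans (by ring)
  have d1 : deriv (fun t : ℝ => Real.exp (0 * t + w * t ^ 2 / 2))
      = fun t => Real.exp (0 * t + w * t ^ 2 / 2) * (w * t) := funext fun t => (hE t).deriv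
  have d2 := hP (fun t => w * t) (fun _ => w) fun t => by
    simpa using (hasDerivAt_id t).const_mul w
  have d3 := hP (fun t => w * t * (w * t) + w) (fun t => 2 * w ^ 2 * t) fun t => by
    have h1 : HasDerivAt (fun t => w * t) w t := by simpa using (hasDerivAt_id t).const_mul w
    convert! (h1.mul h1).add_const w using 1
    ring
  have d4 := hP (fun t => w * t * (w * t * (w * t) + w) + 2 * w ^ 2 * t)
      (fun t => 3 * w ^ 3 * t ^ 2 + 3 * w ^ 2) fun t => by
    have h1 : HasDerivAt (fun t => w * t) w t := by simpa using (hasDerivAt_id t).const_mul w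
    convert! (h1.mul ((h1.mul h1).add_const w)).add ((hasDerivAt_id t).const_mul (2 * w ^ 2))
      using 1
    simp; ring
  rw [iteratedDeriv_succ, iteratedDeriv_succ, iteratedDeriv_succ, iteratedDeriv_one, d1, d2, d3, d4]
  simp

/-- `L²` convergence implies convergence in law, hence of characteristic functions, and those of
centred Gaussians depend continuously on the variance. -/
theorem hasLaw_gaussianReal_of_tendsto {Ω : Type*} [MeasurableSpace Ω] {P : Measure Ω}
    [IsProbabilityMeasure P] {X : ℕ → Ω → ℝ} {Y : Ω → ℝ} {v : ℕ → ℝ≥0} {w : ℝ≥0}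
    (hX : ∀ n, HasLaw (X n) (gaussianReal 0 (v n)) P) (hv : Tendsto v atTop (𝓝 w))
    (hY : AEMeasurable Y P)
    (hXY : Tendsto (fun n => eLpNorm (fun ω => X n ω - Y ω) 2 P) atTop (𝓝 0)) :
    HasLaw Y (gaussianReal 0 w) P := by
  refine ⟨hY, ?_⟩
  have hm : TendstoInMeasure P X atTop Y :=
    tendstoInMeasure_of_tendsto_eLpNorm two_ne_zero
      (fun n => (hX n).aemeasurable.aestronglyMeasurable) hY.aestronglyMeasurable hXY
  have hd := hm.tendstoInDistribution_of_aemeasurable (fun n => (hX n).aemeasurable) hY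
  have hcf := ProbabilityMeasure.tendsto_iff_tendsto_charFun.1 hd.tendsto
  have : IsProbabilityMeasure (P.map Y) := Measure.isProbabilityMeasure_map hY
  refine Measure.ext_of_charFun (funext fun t => tendsto_nhds_unique (hcf t) ?_)
  simp only [ProbabilityMeasure.coe_mk, (hX _).map_eq, charFun_gaussianReal]
  refine (Complex.continuous_exp.tendsto _).comp ?_
  refine tendsto_const_nhds.sub ((Tendsto.mul_const _ ?_).div_const _)
  exact (Complex.continuous_ofReal.tendsto _).comp ((NNReal.continuous_coe.tendsto _).comp hv)

theorem integral_sq_eq_toReal_eLpNorm_sq {α : Type*} [MeasurableSpace α] {μ : Measure α} {f : α → ℝ}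
    (hf : MemLp f 2 μ) : ∫ x, f x ^ 2 ∂μ = (eLpNorm f 2 μ).toReal ^ 2 := by
  rw [hf.eLpNorm_eq_integral_rpow_norm two_ne_zero ENNReal.ofNat_ne_top]
  simp only [ENNReal.toReal_ofNat, Real.rpow_ofNat, Real.norm_eq_abs, sq_abs]
  rw [ENNReal.toReal_ofReal (by positivity), ← Real.rpow_natCast, ← Real.rpow_mul
    (integral_nonneg fun x => sq_nonneg _)]
  simp

theorem tendsto_integral_sq_of_tendsto_eLpNorm {α : Type*} [MeasurableSpace α] {μ : Measure α}
    {f : ℕ → α → ℝ} {g : α → ℝ} (hf : ∀ n, MemLp (f n) 2 μ) (hg : MemLp g 2 μ)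
    (h : Tendsto (fun n => eLpNorm (fun x => f n x - g x) 2 μ) atTop (𝓝 0)) :
    Tendsto (fun n => ∫ x, f n x ^ 2 ∂μ) atTop (𝓝 (∫ x, g x ^ 2 ∂μ)) := by
  have h1 : Tendsto (fun n => (hf n).toLp (f n)) atTop (𝓝 (hg.toLp g)) :=
    (Lp.tendsto_Lp_iff_tendsto_eLpNorm'' f hf g hg).2 h
  have h2 := (h1.norm).pow 2
  simp only [Lp.norm_toLp] at h2
  simpa only [integral_sq_eq_toReal_eLpNorm_sq (hf _), integral_sq_eq_toReal_eLpNorm_sq hg] using h2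

theorem tendsto_eLpNorm_add_mul_sub {α : Type*} [MeasurableSpace α] {μ : Measure α}
    {a b : ℕ → α → ℝ} {a' b' : α → ℝ} (c : ℝ)
    (ham : ∀ n, AEStronglyMeasurable (fun x => a n x - a' x) μ)
    (hbm : ∀ n, AEStronglyMeasurable (fun x => b n x - b' x) μ)
    (ha : Tendsto (fun n => eLpNorm (fun x => a n x - a' x) 2 μ) atTop (𝓝 0))
    (hb : Tendsto (fun n => eLpNorm (fun x => b n x - b' x) 2 μ) atTop (𝓝 0)) :
    Tendsto (fun n => eLpNorm (fun x => (a n x + c * b n x) - (a' x + c * b' x)) 2 μ) atTop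
      (𝓝 0) := by
  have hlim : Tendsto (fun n => eLpNorm (fun x => a n x - a' x) 2 μ
      + ‖c‖ₑ * eLpNorm (fun x => b n x - b' x) 2 μ) atTop (𝓝 0) := by
    simpa using ha.add (ENNReal.Tendsto.const_mul hb (Or.inr enorm_ne_top))
  refine tendsto_of_tendsto_of_tendsto_of_le_of_le tendsto_const_nhds hlim
    (fun _ => zero_le) fun n => ?_
  have e : (fun x => (a n x + c * b n x) - (a' x + c * b' x))
      = (fun x => a n x - a' x) + c • (fun x => b n x - b' x) := by
    ext x; simp; ring
  rw [e]
  refine (eLpNorm_add_le (ham n) ((hbm n).const_smul c) one_le_two).trans ?_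
  rw [eLpNorm_const_smul]

/-! ### White noise evaluated on `L²` functions, and Wick's formula. -/

namespace StochasticBurgers

variable {Ω : Type*} [MeasurableSpace Ω]

theorem exists_tendsto_schwartz {f : ℝ → ℝ} (hf : MemLp f 2 volume) :
    ∃ u : ℕ → 𝓢(ℝ, ℝ), Tendsto (fun n => eLpNorm (fun y => u n y - f y) 2 volume) atTop (𝓝 0) := by
  have hd := SchwartzMap.denseRange_toLpCLM (E := ℝ) (F := ℝ) (p := 2) (μ := volume)
    ENNReal.ofNat_ne_top
  obtain ⟨x, hx, hlim⟩ := mem_closure_iff_seq_limit.1 (hd (hf.toLp f))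
  choose u hu using hx
  refine ⟨u, ?_⟩
  have hlim' : Tendsto (fun n => ((u n).memLp 2 volume).toLp (u n)) atTop (𝓝 (hf.toLp f)) := by
    refine hlim.congr fun n => ?_
    rw [← hu n]; rfl
  exact (Lp.tendsto_Lp_iff_tendsto_eLpNorm'' _ (fun n => (u n).memLp 2 volume) f hf).1 hlim'

/-- The isometry property of white noise, for `L²` limits of test functions. -/
theorem IsWhiteNoise.hasLaw_of_tendsto {P : Measure Ω} [IsProbabilityMeasure P] {χ : ℝ}
    {W : Ω → TempDist} (hW : IsWhiteNoise P χ W) {f : ℝ → ℝ} (hf : MemLp f 2 volume)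
    {X : Ω → ℝ} (hX : AEMeasurable X P) {u : ℕ → 𝓢(ℝ, ℝ)}
    (hu : Tendsto (fun n => eLpNorm (fun y => u n y - f y) 2 volume) atTop (𝓝 0))
    (hWu : Tendsto (fun n => eLpNorm (fun ω => W ω (u n) - X ω) 2 P) atTop (𝓝 0)) :
    HasLaw X (gaussianReal 0 (χ * ∫ x, f x ^ 2).toNNReal) P :=
  hasLaw_gaussianReal_of_tendsto (fun n => hW (u n))
    ((continuous_real_toNNReal.tendsto _).comp
      ((tendsto_integral_sq_of_tendsto_eLpNorm (fun n => (u n).memLp 2 volume) hf hu).const_mul χ))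
    hX hWu

/-- Linear combinations of values of a white noise on `L²` are Gaussian. -/
theorem IsWhiteNoise.hasLaw_add_smul {P : Measure Ω} [IsProbabilityMeasure P] {χ : ℝ}
    {W : Ω → TempDist} (hW : IsWhiteNoise P χ W) {f g : ℝ → ℝ} (hf : MemLp f 2 volume)
    (hg : MemLp g 2 volume) {X Y : Ω → ℝ} (hX : AEMeasurable X P) (hY : AEMeasurable Y P)
    (hfX : IsL2Value P W f X) (hgY : IsL2Value P W g Y) (c : ℝ) :
    HasLaw (fun ω => X ω + c * Y ω)
      (gaussianReal 0 (χ * ∫ x, (f x + c * g x) ^ 2).toNNReal) P := by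
  obtain ⟨u, hu⟩ := exists_tendsto_schwartz hf
  obtain ⟨v, hv⟩ := exists_tendsto_schwartz hg
  refine hW.hasLaw_of_tendsto (u := fun n => u n + c • v n) (hf.add (hg.const_mul c))
    (hX.add (hY.const_mul c)) ?_ ?_
  · exact tendsto_eLpNorm_add_mul_sub c (fun n => (((u n).memLp 2 volume).sub hf).1)
      (fun n => (((v n).memLp 2 volume).sub hg).1) hu hv
  · have h := tendsto_eLpNorm_add_mul_sub c
      (fun n => ((hW (u n)).aemeasurable.sub hX).aestronglyMeasurable)
      (fun n => ((hW (v n)).aemeasurable.sub hY).aestronglyMeasurable) (hfX u hu) (hgY v hv)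
    simpa only [map_add, map_smul, smul_eq_mul] using h

end StochasticBurgers

theorem integrable_pow_four_of_hasLaw {Ω : Type*} [MeasurableSpace Ω] {P : Measure Ω}
    {X : Ω → ℝ} {v : ℝ≥0} (hX : HasLaw X (gaussianReal 0 v) P) :
    Integrable (fun ω => X ω ^ 4) P := by
  have h : Integrable (fun x : ℝ => x ^ 4) (gaussianReal 0 v) := by
    have := (memLp_id_gaussianReal (μ := 0) (v := v) 4).integrable_norm_pow (by norm_num)
    refine this.congr (Eventually.of_forall fun x => ?_)
    simp only [id, Real.norm_eq_abs]
    exact (Even.pow_abs (by decide) x)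
  rw [← hX.map_eq] at h
  exact h.comp_aemeasurable hX.aemeasurable

theorem integral_pow_four_of_hasLaw {Ω : Type*} [MeasurableSpace Ω] {P : Measure Ω}
    {X : Ω → ℝ} {v : ℝ≥0} (hX : HasLaw X (gaussianReal 0 v) P) :
    ∫ ω, X ω ^ 4 ∂P = 3 * (v : ℝ) ^ 2 := by
  rw [← integral_pow_four_gaussianReal v]
  exact hX.integral_comp (f := fun x : ℝ => x ^ 4) (by fun_prop)

namespace StochasticBurgers

variable {Ω : Type*} [MeasurableSpace Ω]

/-- The covariance of the squares of two values of a white noise (Wick's formula). -/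
theorem IsWhiteNoise.integral_sq_mul_sq {P : Measure Ω} [IsProbabilityMeasure P] {χ : ℝ}
    (hχ : 0 ≤ χ) {W : Ω → TempDist} (hW : IsWhiteNoise P χ W) {f g : ℝ → ℝ}
    (hf : MemLp f 2 volume) (hg : MemLp g 2 volume) {X Y : Ω → ℝ} (hX : AEMeasurable X P)
    (hY : AEMeasurable Y P) (hfX : IsL2Value P W f X) (hgY : IsL2Value P W g Y) :
    Integrable (fun ω => X ω ^ 2 * Y ω ^ 2) P ∧
    ∫ ω, X ω ^ 2 * Y ω ^ 2 ∂P
      = χ ^ 2 * ((∫ x, f x ^ 2) * (∫ x, g x ^ 2) + 2 * (∫ x, f x * g x) ^ 2) := by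
  have i1 := hf.integrable_sq
  have i2 := hg.integrable_sq
  have i3 : Integrable (fun x => f x * g x) := hf.integrable_mul hg
  have hvar : ∀ c : ℝ, ∫ x, (f x + c * g x) ^ 2
      = (∫ x, f x ^ 2) + 2 * c * (∫ x, f x * g x) + c ^ 2 * ∫ x, g x ^ 2 := fun c => by
    have e : ∀ x, (f x + c * g x) ^ 2 = f x ^ 2 + 2 * c * (f x * g x) + c ^ 2 * g x ^ 2 :=
      fun x => by ring
    simp_rw [e]
    have i4 : Integrable (fun x => f x ^ 2 + 2 * c * (f x * g x)) := i1.add (i3.const_mul _)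
    rw [integral_add i4 (i2.const_mul _), integral_add i1 (i3.const_mul _),
      integral_const_mul, integral_const_mul]
  have law := hW.hasLaw_add_smul hf hg hX hY hfX hgY
  have law' := hW.hasLaw_add_smul hg hf hY hX hgY hfX
  have hcoe : ∀ F : ℝ → ℝ, ((χ * ∫ x, F x ^ 2).toNNReal : ℝ) = χ * ∫ x, F x ^ 2 := fun F =>
    Real.coe_toNNReal _ (mul_nonneg hχ (integral_nonneg fun x => sq_nonneg _))
  have j1 := integrable_pow_four_of_hasLaw (law 1)
  have j2 := integrable_pow_four_of_hasLaw (law (-1))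
  -- Coefficient 0 gives the laws of `X` and `Y` themselves.
  have j3 := integrable_pow_four_of_hasLaw (law 0)
  have j4 := integrable_pow_four_of_hasLaw (law' 0)
  have k1 := integral_pow_four_of_hasLaw (law 1)
  have k2 := integral_pow_four_of_hasLaw (law (-1))
  have k3 := integral_pow_four_of_hasLaw (law 0)
  have k4 := integral_pow_four_of_hasLaw (law' 0)
  rw [hcoe fun x => f x + 1 * g x, hvar] at k1
  rw [hcoe fun x => f x + -1 * g x, hvar] at k2
  rw [hcoe fun x => f x + 0 * g x] at k3
  rw [hcoe fun x => g x + 0 * f x] at k4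
  simp only [zero_mul, add_zero] at j3 j4 k3 k4
  -- Polarization reduces the mixed moment to fourth moments of single Gaussian variables, so no
  -- joint law is needed.
  have e : ∀ ω, X ω ^ 2 * Y ω ^ 2 = 1 / 12 * ((X ω + 1 * Y ω) ^ 4 + (X ω + -1 * Y ω) ^ 4
      - 2 * X ω ^ 4 - 2 * Y ω ^ 4) := fun ω => by ring
  simp_rw [e]
  refine ⟨(((j1.add j2).sub (j3.const_mul 2)).sub (j4.const_mul 2)).const_mul _, ?_⟩
  have j5 : Integrable (fun ω => (X ω + 1 * Y ω) ^ 4 + (X ω + -1 * Y ω) ^ 4) P := j1.add j2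
  have j6 : Integrable (fun ω => (X ω + 1 * Y ω) ^ 4 + (X ω + -1 * Y ω) ^ 4 - 2 * X ω ^ 4) P :=
    j5.sub (j3.const_mul 2)
  rw [integral_const_mul, integral_sub j6 (j4.const_mul 2), integral_sub j5 (j3.const_mul 2), integral_add j1 j2, integral_const_mul,
    integral_const_mul, k1, k2, k3, k4]
  ring

theorem memLp_approxId (ε x : ℝ) : MemLp (approxId ε x) 2 volume :=
  memLp_indicator_const 2 measurableSet_Ioc _ (Or.inr (by simp))

theorem integral_approxId_mul (ε x y : ℝ) :
    ∫ z, approxId ε x z * approxId ε y z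
      = ε⁻¹ ^ 2 * volume.real (Ioc x (x + ε) ∩ Ioc y (y + ε)) := by
  have : (fun z => approxId ε x z * approxId ε y z)
      = (Ioc x (x + ε) ∩ Ioc y (y + ε)).indicator fun _ => ε⁻¹ ^ 2 := by
    ext z
    simp only [approxId, ← Set.inter_indicator_mul]
    rw [sq]
  rw [this, integral_indicator_const _ (measurableSet_Ioc.inter measurableSet_Ioc), smul_eq_mul,
    mul_comm]

theorem integral_approxId_sq {ε : ℝ} (hε : 0 < ε) (x : ℝ) :
    ∫ z, approxId ε x z ^ 2 = ε⁻¹ := by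
  simp_rw [sq]
  rw [integral_approxId_mul, inter_self, measureReal_def, Real.volume_Ioc]
  simp [hε.le]
  field_simp

/-- The two windows overlap in length at most `ε`, and only if `|x - y| < ε`. Integrating in `y`
over this set of length `2ε` therefore leaves `2 / ε`, one power better than the uniform bound
`ε⁻²`. -/
theorem sq_integral_approxId_mul_le {ε : ℝ} (hε : 0 < ε) (x y : ℝ) :
    (∫ z, approxId ε x z * approxId ε y z) ^ 2
      ≤ (Ioo (x - ε) (x + ε)).indicator (fun _ => ε⁻¹ ^ 2) y := by
  rw [integral_approxId_mul]
  by_cases hy : y ∈ Ioo (x - ε) (x + ε)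
  · rw [indicator_of_mem hy]
    have h1 : volume.real (Ioc x (x + ε) ∩ Ioc y (y + ε)) ≤ ε := by
      refine (measureReal_mono inter_subset_left (by simp)).trans_eq ?_
      rw [measureReal_def, Real.volume_Ioc]
      simp [hε.le]
    have h0 : 0 ≤ volume.real (Ioc x (x + ε) ∩ Ioc y (y + ε)) := measureReal_nonneg
    calc (ε⁻¹ ^ 2 * volume.real (Ioc x (x + ε) ∩ Ioc y (y + ε))) ^ 2
        ≤ (ε⁻¹ ^ 2 * ε) ^ 2 := by gcongr
      _ = ε⁻¹ ^ 2 := by field_simp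
  · have : Ioc x (x + ε) ∩ Ioc y (y + ε) = ∅ := by
      ext z
      simp only [mem_inter_iff, mem_Ioc, mem_empty_iff_false, iff_false, not_and]
      rintro ⟨h1, h2⟩ h3 h4
      exact hy ⟨by linarith, by linarith⟩
    rw [indicator_of_notMem hy, this]
    simp

end StochasticBurgers

/-! ### Second moments of time integrals. -/

theorem ofReal_sq_eq_enorm_sq (x : ℝ) : ENNReal.ofReal (x ^ 2) = ‖x‖ₑ ^ 2 := by
  rw [← sq_abs, ENNReal.ofReal_pow (abs_nonneg x), ← Real.norm_eq_abs, ofReal_norm]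

theorem eLpNorm_two_eq_rpow {α : Type*} [MeasurableSpace α] {μ : Measure α} (f : α → ℝ) :
    eLpNorm f 2 μ = (∫⁻ x, ENNReal.ofReal (f x ^ 2) ∂μ) ^ (1 / 2 : ℝ) := by
  rw [eLpNorm_eq_lintegral_rpow_enorm_toReal two_ne_zero ENNReal.ofNat_ne_top]
  simp [ofReal_sq_eq_enorm_sq]

theorem eLpNorm_two_sq {α : Type*} [MeasurableSpace α] {μ : Measure α} (f : α → ℝ) :
    eLpNorm f 2 μ ^ 2 = ∫⁻ x, ENNReal.ofReal (f x ^ 2) ∂μ := by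
  rw [eLpNorm_two_eq_rpow, ← ENNReal.rpow_natCast, ← ENNReal.rpow_mul]
  simp

/-- The Cauchy–Schwarz inequality against the constant function. -/
theorem sq_lintegral_enorm_le {α : Type*} [MeasurableSpace α] {μ : Measure α} {f : α → ℝ}
    (hf : AEStronglyMeasurable f μ) :
    (∫⁻ x, ‖f x‖ₑ ∂μ) ^ 2 ≤ μ univ * ∫⁻ x, ‖f x‖ₑ ^ 2 ∂μ := by
  have h := eLpNorm_le_eLpNorm_mul_rpow_measure_univ (μ := μ) (p := 1) (q := 2) one_le_two hf
  rw [eLpNorm_one_eq_lintegral_enorm] at h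
  calc (∫⁻ x, ‖f x‖ₑ ∂μ) ^ 2
      ≤ (eLpNorm f 2 μ * μ univ ^ (1 / (1 : ℝ≥0∞).toReal - 1 / (2 : ℝ≥0∞).toReal)) ^ 2 := by gcongr
    _ = μ univ * ∫⁻ x, ‖f x‖ₑ ^ 2 ∂μ := by
      rw [mul_pow, eLpNorm_two_sq, ← ENNReal.rpow_natCast, ← ENNReal.rpow_mul, mul_comm]
      simp only [ofReal_sq_eq_enorm_sq]
      congr 1
      norm_num

section TimeIntegral

variable {Ω : Type*} [MeasurableSpace Ω] {P : Measure Ω} {T K : ℝ} {F : ℝ → Ω → ℝ}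

/-- Measurability is known only over `[0, T]`. Freezing the time at the endpoints extends it to `ℝ ×
Ω`, where Fubini's theorem applies. -/
theorem exists_measurable_eqOn_Icc (hT : 0 ≤ T)
    (hF : Measurable fun p : Icc (0 : ℝ) T × Ω => F p.1 p.2) :
    ∃ G : ℝ → Ω → ℝ, Measurable (Function.uncurry G) ∧ ∀ r ∈ Icc 0 T, G r = F r := by
  refine ⟨fun r ω => F (projIcc 0 T hT r) ω, ?_, fun r hr => ?_⟩
  · have h : Measurable fun p : ℝ × Ω => (projIcc 0 T hT p.1, p.2) :=
      (continuous_projIcc.measurable.comp measurable_fst).prodMk measurable_snd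
    exact hF.comp h
  · simp only [projIcc_of_mem hT hr]

theorem intervalIntegral_eq_of_eqOn_Icc {f g : ℝ → ℝ} {s t : ℝ} (hs : s ∈ Icc 0 T)
    (ht : t ∈ Icc 0 T) (h : ∀ r ∈ Icc 0 T, g r = f r) :
    ∫ r in s..t, g r = ∫ r in s..t, f r :=
  intervalIntegral.integral_congr fun r hr => h r (uIcc_subset_Icc hs ht hr)

theorem measurable_intervalIntegral (hT : 0 ≤ T)
    (hF : Measurable fun p : Icc (0 : ℝ) T × Ω => F p.1 p.2) {s t : ℝ} (hs : s ∈ Icc 0 T)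
    (ht : t ∈ Icc 0 T) : Measurable fun ω => ∫ r in s..t, F r ω := by
  obtain ⟨G, hG, hGF⟩ := exists_measurable_eqOn_Icc hT hF
  have e : (fun ω => ∫ r in s..t, F r ω) = fun ω => ∫ r in s..t, G r ω := funext fun ω =>
    (intervalIntegral_eq_of_eqOn_Icc hs ht fun r hr => by rw [hGF r hr]).symm
  rw [e]
  simp only [intervalIntegral]
  exact ((hG.stronglyMeasurable.integral_prod_left (μ := volume.restrict (Ioc s t))).sub
    (hG.stronglyMeasurable.integral_prod_left (μ := volume.restrict (Ioc t s)))).measurable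

theorem lintegral_lintegral_Ioc_enorm_sq_le [SFinite P] {G : ℝ → Ω → ℝ}
    (hG : Measurable (Function.uncurry G))
    (hK : ∀ r ∈ Icc 0 T, ∫⁻ ω, ENNReal.ofReal (G r ω ^ 2) ∂P ≤ ENNReal.ofReal K) {s t : ℝ}
    (hs : s ∈ Icc 0 T) (ht : t ∈ Icc 0 T) :
    ∫⁻ ω, (∫⁻ r in Ioc s t, ‖G r ω‖ₑ ^ 2) ∂P ≤ ENNReal.ofReal K * ENNReal.ofReal (t - s) := by
  have hm : Measurable (Function.uncurry fun ω r => ‖G r ω‖ₑ ^ 2) :=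
    (hG.comp measurable_swap).enorm.pow_const 2
  rw [lintegral_lintegral_swap hm.aemeasurable]
  calc ∫⁻ r in Ioc s t, ∫⁻ ω, ‖G r ω‖ₑ ^ 2 ∂P
      ≤ ∫⁻ _ in Ioc s t, ENNReal.ofReal K :=
        setLIntegral_mono measurable_const fun r hr => by
          simp_rw [← ofReal_sq_eq_enorm_sq]
          exact hK r ⟨hs.1.trans hr.1.le, hr.2.trans ht.2⟩
    _ = ENNReal.ofReal K * ENNReal.ofReal (t - s) := by
        rw [setLIntegral_const, Real.volume_Ioc]

theorem ae_intervalIntegrable_of_second_moment_le [SFinite P] (hT : 0 ≤ T)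
    (hF : Measurable fun p : Icc (0 : ℝ) T × Ω => F p.1 p.2)
    (hK : ∀ r ∈ Icc 0 T, ∫⁻ ω, ENNReal.ofReal (F r ω ^ 2) ∂P ≤ ENNReal.ofReal K) :
    ∀ᵐ ω ∂P, IntervalIntegrable (fun r => F r ω) volume 0 T := by
  obtain ⟨G, hG, hGF⟩ := exists_measurable_eqOn_Icc hT hF
  have h := lintegral_lintegral_Ioc_enorm_sq_le (P := P) (K := K) hG
    (fun r hr => by rw [hGF r hr]; exact hK r hr) (left_mem_Icc.2 hT) (right_mem_Icc.2 hT)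
  have hm : Measurable (Function.uncurry fun ω r => ‖G r ω‖ₑ ^ 2) :=
    (hG.comp measurable_swap).enorm.pow_const 2
  filter_upwards [ae_lt_top hm.lintegral_prod_right' (ne_top_of_le_ne_top
    (ENNReal.mul_ne_top ENNReal.ofReal_ne_top ENNReal.ofReal_ne_top) h)] with ω hω
  have hGω : Measurable fun r => G r ω := hG.comp measurable_prodMk_right
  have hint : IntegrableOn (fun r => G r ω) (Ioc 0 T) volume := by
    refine ⟨hGω.aestronglyMeasurable, ?_⟩
    have h2 := sq_lintegral_enorm_le (μ := volume.restrict (Ioc 0 T)) (f := fun r => G r ω)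
      hGω.aestronglyMeasurable
    have h3 : (∫⁻ r in Ioc 0 T, ‖G r ω‖ₑ) ^ 2 < ∞ :=
      h2.trans_lt (ENNReal.mul_lt_top (by simp) hω)
    exact (ENNReal.pow_lt_top_iff.1 h3).resolve_right two_ne_zero
  rw [intervalIntegrable_iff_integrableOn_Ioc_of_le hT]
  refine hint.congr_fun (fun r hr => ?_) measurableSet_Ioc
  simp only [hGF r (Ioc_subset_Icc_self hr)]

/-- Cauchy–Schwarz in time gives one factor `t - s`, and Tonelli with the uniform bound `K` gives
the other. -/
theorem lintegral_sq_intervalIntegral_le [SFinite P] (hT : 0 ≤ T)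
    (hF : Measurable fun p : Icc (0 : ℝ) T × Ω => F p.1 p.2) (hK0 : 0 ≤ K)
    (hK : ∀ r ∈ Icc 0 T, ∫⁻ ω, ENNReal.ofReal (F r ω ^ 2) ∂P ≤ ENNReal.ofReal K) {s t : ℝ}
    (hs : s ∈ Icc 0 T) (ht : t ∈ Icc 0 T) (hst : s ≤ t) :
    ∫⁻ ω, ENNReal.ofReal ((∫ r in s..t, F r ω) ^ 2) ∂P ≤ ENNReal.ofReal (K * (t - s) ^ 2) := by
  obtain ⟨G, hG, hGF⟩ := exists_measurable_eqOn_Icc hT hF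
  have h := lintegral_lintegral_Ioc_enorm_sq_le (P := P) (K := K) hG
    (fun r hr => by rw [hGF r hr]; exact hK r hr) hs ht
  have hm : Measurable (Function.uncurry fun ω r => ‖G r ω‖ₑ ^ 2) :=
    (hG.comp measurable_swap).enorm.pow_const 2
  calc ∫⁻ ω, ENNReal.ofReal ((∫ r in s..t, F r ω) ^ 2) ∂P
      ≤ ∫⁻ ω, ENNReal.ofReal (t - s) * (∫⁻ r in Ioc s t, ‖G r ω‖ₑ ^ 2) ∂P := by
        refine lintegral_mono fun ω => ?_
        have hGω : Measurable fun r => G r ω := hG.comp measurable_prodMk_right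
        rw [← intervalIntegral_eq_of_eqOn_Icc (g := fun r => G r ω) hs ht
          (fun r hr => by rw [hGF r hr]), intervalIntegral.integral_of_le hst,
          ofReal_sq_eq_enorm_sq]
        have h2 := sq_lintegral_enorm_le (μ := volume.restrict (Ioc s t)) (f := fun r => G r ω)
          hGω.aestronglyMeasurable
        rw [Measure.restrict_apply_univ, Real.volume_Ioc] at h2
        refine le_trans ?_ h2
        gcongr
        exact enorm_integral_le_lintegral_enorm _
    _ = ENNReal.ofReal (t - s) * ∫⁻ ω, (∫⁻ r in Ioc s t, ‖G r ω‖ₑ ^ 2) ∂P :=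
        lintegral_const_mul _ hm.lintegral_prod_right'
    _ ≤ ENNReal.ofReal (t - s) * (ENNReal.ofReal K * ENNReal.ofReal (t - s)) := by gcongr
    _ = ENNReal.ofReal (K * (t - s) ^ 2) := by
        have := sub_nonneg.2 hst
        rw [← ENNReal.ofReal_mul hK0, ← ENNReal.ofReal_mul this]
        congr 1; ring

end TimeIntegral

/-! ### The squared averaged field tested against a function of zero integral. -/

namespace StochasticBurgers

variable {Ω : Type*} [MeasurableSpace Ω]

/-- The second moment of `∫ W(i_ε(x))² h(x) dx` is of order `ε⁻¹` if `∫ h = 0`. -/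
theorem IsWhiteNoise.lintegral_sq_integral_le {P : Measure Ω} [IsProbabilityMeasure P] {χ : ℝ}
    (hχ : 0 ≤ χ) {W : Ω → TempDist} (hW : IsWhiteNoise P χ W) {ε : ℝ} (hε : 0 < ε)
    {ζ : ℝ → Ω → ℝ} (hζ : Measurable (Function.uncurry ζ))
    (hζW : ∀ x, IsL2Value P W (approxId ε x) (ζ x)) {h : ℝ → ℝ} (hm : Measurable h)
    (hi : Integrable h) (h0 : ∫ x, h x = 0) {S : ℝ} (hS : ∀ x, |h x| ≤ S) :
    ∫⁻ ω, ENNReal.ofReal ((∫ x, ζ x ω ^ 2 * h x) ^ 2) ∂P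
      ≤ ENNReal.ofReal (4 * χ ^ 2 * S * (∫ x, |h x|) / ε) := by
  set c : ℝ → ℝ → ℝ := fun x y => ∫ z, approxId ε x z * approxId ε y z with hc
  set Φ : (ℝ × ℝ) × Ω → ℝ := fun q => (ζ q.1.1 q.2 ^ 2 * h q.1.1) * (ζ q.1.2 q.2 ^ 2 * h q.1.2)
    with hΦ
  have hζx : ∀ x, AEMeasurable (ζ x) P := fun x => (hζ.comp measurable_prodMk_left).aemeasurable
  have hS0 : 0 ≤ S := (abs_nonneg _).trans (hS 0)
  have hcov : ∀ x y, Integrable (fun ω => ζ x ω ^ 2 * ζ y ω ^ 2) P ∧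
      ∫ ω, ζ x ω ^ 2 * ζ y ω ^ 2 ∂P = χ ^ 2 * (ε⁻¹ * ε⁻¹ + 2 * c x y ^ 2) := fun x y => by
    have := hW.integral_sq_mul_sq hχ (memLp_approxId ε x) (memLp_approxId ε y) (hζx x) (hζx y)
      (hζW x) (hζW y)
    rwa [integral_approxId_sq hε, integral_approxId_sq hε] at this
  have hcle : ∀ x y, c x y ^ 2 ≤ ε⁻¹ ^ 2 := fun x y =>
    (sq_integral_approxId_mul_le hε x y).trans
      (indicator_le_self' (fun _ _ => by positivity) _)
  have hΦm : Measurable Φ := by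
    have h1 : Measurable fun q : (ℝ × ℝ) × Ω => ζ q.1.1 q.2 :=
      hζ.comp ((measurable_fst.comp measurable_fst).prodMk measurable_snd)
    have h2 : Measurable fun q : (ℝ × ℝ) × Ω => ζ q.1.2 q.2 :=
      hζ.comp ((measurable_snd.comp measurable_fst).prodMk measurable_snd)
    fun_prop
  have hΦe : ∀ x y ω, Φ ((x, y), ω) = (h x * h y) * (ζ x ω ^ 2 * ζ y ω ^ 2) := fun x y ω => by
    simp only [hΦ]; ring
  have hΦω : ∀ x y, ∫ ω, Φ ((x, y), ω) ∂P = h x * h y * (χ ^ 2 * (ε⁻¹ * ε⁻¹ + 2 * c x y ^ 2)) :=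
    fun x y => by
      simp_rw [hΦe]
      rw [integral_const_mul, (hcov x y).2]
  -- The covariance formula bounds the `ω`-integral of `|Φ|` by a multiple of `|h x| |h y|`, which
  -- justifies every exchange of integrals below.
  have hΦi : Integrable Φ ((volume.prod volume).prod P) := by
    rw [integrable_prod_iff hΦm.aestronglyMeasurable]
    refine ⟨Eventually.of_forall fun p => ?_, ?_⟩
    · obtain ⟨x, y⟩ := p
      simp_rw [hΦe]
      exact (hcov x y).1.const_mul _
    · refine Integrable.mono' ((hi.abs.mul_prod hi.abs).mul_const (3 * χ ^ 2 * ε⁻¹ ^ 2))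
        hΦm.norm.stronglyMeasurable.integral_prod_right'.aestronglyMeasurable
        (Eventually.of_forall fun p => ?_)
      obtain ⟨x, y⟩ := p
      have e : ∀ ω, ‖Φ ((x, y), ω)‖ = |h x| * |h y| * (ζ x ω ^ 2 * ζ y ω ^ 2) := fun ω => by
        rw [hΦe, norm_mul, Real.norm_eq_abs, Real.norm_eq_abs, abs_mul,
          abs_of_nonneg (mul_nonneg (sq_nonneg (ζ x ω)) (sq_nonneg (ζ y ω)))]
      simp_rw [e]
      rw [integral_const_mul, (hcov x y).2, Real.norm_of_nonneg (by positivity)]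
      have h3 : χ ^ 2 * (ε⁻¹ * ε⁻¹ + 2 * c x y ^ 2) ≤ 3 * χ ^ 2 * ε⁻¹ ^ 2 := by
        nlinarith [mul_le_mul_of_nonneg_left (hcle x y) (sq_nonneg χ)]
      gcongr
  have hsq : ∀ ω, (∫ x, ζ x ω ^ 2 * h x) ^ 2 = ∫ p, Φ (p, ω) ∂(volume.prod volume) := fun ω => by
    rw [sq, ← integral_prod_mul]
  simp_rw [hsq]
  rw [← ofReal_integral_eq_lintegral_ofReal hΦi.integral_prod_right
    (Eventually.of_forall fun ω => by simp only [Pi.zero_apply, ← hsq]; positivity)]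
  refine ENNReal.ofReal_le_ofReal ?_
  rw [← integral_prod_symm _ hΦi, integral_prod _ hΦi]
  have hi2 : Integrable (fun p : ℝ × ℝ => ∫ ω, Φ (p, ω) ∂P) (volume.prod volume) :=
    hΦi.integral_prod_left
  have hhi : Integrable (fun p : ℝ × ℝ => h p.1 * h p.2 * (χ ^ 2 * (ε⁻¹ * ε⁻¹)))
      (volume.prod volume) := (hi.mul_prod hi).mul_const _
  -- The product of the variances, of order `ε⁻²`, is constant in `(x, y)` and vanishes because `∫ h
  -- = 0`. Only the squared covariance survives.
  have hsplit : ∫ p, (∫ ω, Φ (p, ω) ∂P) ∂(volume.prod volume)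
      = ∫ p, h p.1 * h p.2 * (2 * χ ^ 2 * c p.1 p.2 ^ 2) ∂(volume.prod volume) := by
    have hz : ∫ p, h p.1 * h p.2 * (χ ^ 2 * (ε⁻¹ * ε⁻¹)) ∂(volume.prod volume) = 0 := by
      rw [integral_mul_const, integral_prod_mul, h0]
      simp
    rw [← sub_zero (∫ p, (∫ ω, Φ (p, ω) ∂P) ∂_), ← hz, ← integral_sub hi2 hhi]
    refine integral_congr_ae (Eventually.of_forall fun p => ?_)
    obtain ⟨x, y⟩ := p
    simp only [hΦω]
    ring
  have hci : Integrable (fun p : ℝ × ℝ => h p.1 * h p.2 * (2 * χ ^ 2 * c p.1 p.2 ^ 2))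
      (volume.prod volume) := by
    refine (hi2.sub hhi).congr (Eventually.of_forall fun p => ?_)
    obtain ⟨x, y⟩ := p
    simp only [Pi.sub_apply, hΦω]
    ring
  rw [hsplit, integral_prod _ hci]
  refine (le_abs_self _).trans ?_
  have hinner : ∀ x, ‖∫ y, h x * h y * (2 * χ ^ 2 * c x y ^ 2)‖ ≤ |h x| * (4 * χ ^ 2 * S / ε) := by
    intro x
    have hb : Integrable ((Ioo (x - ε) (x + ε)).indicator
        fun _ => |h x| * S * (2 * χ ^ 2 * ε⁻¹ ^ 2)) volume :=
      (integrable_indicator_iff measurableSet_Ioo).2 (integrableOn_const (by simp))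
    refine (norm_integral_le_of_norm_le hb (Eventually.of_forall fun y => ?_)).trans_eq ?_
    · rw [Real.norm_eq_abs, abs_mul, abs_mul, abs_of_nonneg (a := 2 * χ ^ 2 * _) (by positivity)]
      have h1 := sq_integral_approxId_mul_le hε x y
      by_cases hy : y ∈ Ioo (x - ε) (x + ε)
      · rw [indicator_of_mem hy] at h1 ⊢
        gcongr
        exact hS y
      · rw [indicator_of_notMem hy] at h1 ⊢
        have : c x y ^ 2 = 0 := le_antisymm h1 (sq_nonneg _)
        simp [this]
    · rw [integral_indicator_const _ measurableSet_Ioo, measureReal_def, Real.volume_Ioo,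
        ENNReal.toReal_ofReal (by linarith), smul_eq_mul]
      field_simp
      ring
  refine (norm_integral_le_of_norm_le (hi.abs.mul_const _)
    (Eventually.of_forall hinner)).trans_eq ?_
  rw [integral_mul_const]
  ring

end StochasticBurgers

/-! ### Fourth moments of continuous martingales by discrete expansion. -/

/-- The terms of order three and four in `d` are absorbed into `d ^ 2` with a coefficient that
vanishes with `δ`. -/
theorem add_pow_four_le {x d K δ : ℝ} (hx : |x| ≤ K) (hd : |d| ≤ δ) :
    (x + d) ^ 4 ≤ x ^ 4 + 4 * (x ^ 3 * d) + 6 * (x ^ 2 * d ^ 2) + (4 * K * δ + δ ^ 2) * d ^ 2 := by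
  have h1 : x * d ≤ K * δ := (le_abs_self _).trans ((abs_mul x d).le.trans
    (mul_le_mul hx hd (abs_nonneg _) ((abs_nonneg _).trans hx)))
  have h2 : d ^ 2 ≤ δ ^ 2 := sq_le_sq' (neg_le_of_abs_le hd) (le_of_abs_le hd)
  nlinarith [mul_le_mul_of_nonneg_right h1 (sq_nonneg d),
    mul_le_mul_of_nonneg_right h2 (sq_nonneg d)]

/-- Young's inequality `2|d| ≤ η d² + 1/η`, with `η` left free so that the `d²` part can be made
small. -/
theorem neg_cube_mul_le {x d K η : ℝ} (hx : |x| ≤ K) (hη : 0 < η) :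
    -(4 * (x ^ 3 * d)) ≤ 2 * K ^ 3 * η * d ^ 2 + 2 * K ^ 3 / η := by
  have h1 : |x ^ 3| ≤ K ^ 3 := by rw [abs_pow]; gcongr
  have hK : 0 ≤ K ^ 3 := (abs_nonneg _).trans h1
  have h2 : -(x ^ 3 * d) ≤ K ^ 3 * |d| := by
    rw [← neg_mul]
    refine (le_abs_self _).trans ?_
    rw [abs_mul, abs_neg]
    gcongr
  have h3 : 2 * |d| ≤ η * d ^ 2 + 1 / η := by
    have : 0 ≤ (η * |d| - 1) ^ 2 / η := by positivity
    have e : (η * |d| - 1) ^ 2 / η = η * d ^ 2 - 2 * |d| + 1 / η := by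
      rw [← sq_abs d]; field_simp; ring
    linarith
  calc -(4 * (x ^ 3 * d)) ≤ 2 * (K ^ 3 * (2 * |d|)) := by linarith
    _ ≤ 2 * (K ^ 3 * (η * d ^ 2 + 1 / η)) := by gcongr
    _ = 2 * K ^ 3 * η * d ^ 2 + 2 * K ^ 3 / η := by ring

section SmallPaths

variable {Ω ι : Type*} {M : ι → Ω → ℝ}

/-- The increments of `M` along `τ` do not exceed `δ` before step `n`. -/
def smallIncrements (M : ι → Ω → ℝ) (τ : ℕ → ι) (δ : ℝ) (n : ℕ) : Set Ω :=
  {ω | ∀ i < n, |M (τ (i + 1)) ω - M (τ i) ω| ≤ δ}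

/-- Moreover `|M (τ i) - M (τ 0)|` does not exceed `K` up to step `n`. -/
def smallPaths (M : ι → Ω → ℝ) (τ : ℕ → ι) (K δ : ℝ) (n : ℕ) : Set Ω :=
  {ω | ∀ i ≤ n, |M (τ i) ω - M (τ 0) ω| ≤ K} ∩ smallIncrements M τ δ n

/-- If the new increment `d` is at most `δ` in size, the expansion of `(x + d) ^ 4` applies whether
or not the level `K` is crossed. If it is larger, the left side is zero but `4 x³ d`, which must be
kept because it has mean zero, may be negative. Young's inequality compensates for it, and its
constant `2 K ^ 3 / η` is charged to the event that an increment exceeds `δ` for the first time, so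
that these charges telescope. -/
theorem indicator_smallPaths_succ_le {τ : ℕ → ι} {K δ η : ℝ} (hK : 0 ≤ K) (hδ : 0 ≤ δ)
    (hη : 0 < η) (n : ℕ) (ω : Ω) :
    (smallPaths M τ K δ (n + 1)).indicator (fun ω => (M (τ (n + 1)) ω - M (τ 0) ω) ^ 4) ω
      ≤ (smallPaths M τ K δ n).indicator (fun ω => (M (τ n) ω - M (τ 0) ω) ^ 4) ω
        + 4 * ((smallPaths M τ K δ n).indicator (fun ω => (M (τ n) ω - M (τ 0) ω) ^ 3) ω
          * (M (τ (n + 1)) ω - M (τ n) ω))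
        + 6 * ((smallPaths M τ K δ n).indicator (fun ω => (M (τ n) ω - M (τ 0) ω) ^ 2) ω
          * (M (τ (n + 1)) ω - M (τ n) ω) ^ 2)
        + (4 * K * δ + δ ^ 2 + 2 * K ^ 3 * η) * (M (τ (n + 1)) ω - M (τ n) ω) ^ 2
        + 2 * K ^ 3 / η * ((smallIncrements M τ δ n).indicator (fun _ => 1) ω
          - (smallIncrements M τ δ (n + 1)).indicator (fun _ => 1) ω) := by
  set x := M (τ n) ω - M (τ 0) ω with hx
  set d := M (τ (n + 1)) ω - M (τ n) ω with hd
  have hxd : M (τ (n + 1)) ω - M (τ 0) ω = x + d := by rw [hx, hd]; ring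
  have hsub : smallIncrements M τ δ (n + 1) ⊆ smallIncrements M τ δ n :=
    fun ω h i hi => h i (by omega)
  have hsub' : smallPaths M τ K δ (n + 1) ⊆ smallPaths M τ K δ n :=
    fun ω h => ⟨fun i hi => h.1 i (by omega), hsub h.2⟩
  have hC : 0 ≤ (4 * K * δ + δ ^ 2 + 2 * K ^ 3 * η) * d ^ 2 := by positivity
  have hE : 0 ≤ 2 * K ^ 3 / η * ((smallIncrements M τ δ n).indicator (fun _ => (1 : ℝ)) ω
          - (smallIncrements M τ δ (n + 1)).indicator (fun _ => 1) ω) := by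
    refine mul_nonneg (by positivity) (sub_nonneg.2 ?_)
    exact indicator_le_indicator_of_subset hsub (fun _ => zero_le_one) ω
  by_cases hn : ω ∈ smallPaths M τ K δ n
  · have hxK : |x| ≤ K := hn.1 n le_rfl
    simp only [indicator_of_mem hn]
    rw [← hx]
    by_cases hdδ : |d| ≤ δ
    · have h1 := add_pow_four_le hxK hdδ
      have h2 : (smallPaths M τ K δ (n + 1)).indicator
          (fun ω => (M (τ (n + 1)) ω - M (τ 0) ω) ^ 4) ω ≤ (x + d) ^ 4 := by
        rw [← hxd]
        exact indicator_le_self' (fun _ _ => by positivity) ω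
      have h3 : 0 ≤ 2 * K ^ 3 * η * d ^ 2 := by positivity
      linarith
    · have h1 : ω ∉ smallIncrements M τ δ (n + 1) := fun h => hdδ (h n (by omega))
      have h2 : ω ∉ smallPaths M τ K δ (n + 1) := fun h => h1 h.2
      rw [indicator_of_notMem h2, indicator_of_notMem h1, indicator_of_mem hn.2, sub_zero, mul_one]
      have h3 := neg_cube_mul_le (d := d) hxK hη
      have h4 : 0 ≤ x ^ 4 := by positivity
      have h5 : 0 ≤ 6 * (x ^ 2 * d ^ 2) := by positivity
      have h6 : 0 ≤ (4 * K * δ + δ ^ 2) * d ^ 2 := by positivity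
      linarith
  · have h2 : ω ∉ smallPaths M τ K δ (n + 1) := fun h => hn (hsub' h)
    simp only [indicator_of_notMem hn, indicator_of_notMem h2]
    linarith

theorem abs_indicator_smallPaths_le {τ : ℕ → ι} {K δ : ℝ} (hK : 0 ≤ K) (n k : ℕ) (ω : Ω) :
    |(smallPaths M τ K δ n).indicator (fun ω => (M (τ n) ω - M (τ 0) ω) ^ k) ω| ≤ K ^ k := by
  by_cases h : ω ∈ smallPaths M τ K δ n
  · rw [indicator_of_mem h, abs_pow]
    gcongr
    exact h.1 n le_rfl
  · rw [indicator_of_notMem h, abs_zero]; positivity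

end SmallPaths

section Martingale

variable {Ω ι : Type*} {m0 : MeasurableSpace Ω} {P : Measure Ω} [Preorder ι] {ℱ : Filtration ι m0}
  {M : ι → Ω → ℝ} {Q : ι → ℝ}

theorem measurableSet_smallIncrements (hM : Martingale M ℱ P) {τ : ℕ → ι} (hτ : Monotone τ)
    (δ : ℝ) (n : ℕ) : MeasurableSet[ℱ (τ n)] (smallIncrements M τ δ n) := by
  have : smallIncrements M τ δ n
      = ⋂ i ∈ Finset.range n, {ω | |M (τ (i + 1)) ω - M (τ i) ω| ≤ δ} := by
    ext ω; simp [smallIncrements]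
  rw [this]
  refine Finset.measurableSet_biInter _ fun i hi => ?_
  have hi' := Finset.mem_range.1 hi
  have h1 := (hM.stronglyAdapted (τ (i + 1))).mono (ℱ.mono (hτ (show i + 1 ≤ n by omega)))
  have h2 := (hM.stronglyAdapted (τ i)).mono (ℱ.mono (hτ hi'.le))
  exact (h1.sub h2).norm.measurable measurableSet_Iic

theorem measurableSet_smallPaths (hM : Martingale M ℱ P) {τ : ℕ → ι} (hτ : Monotone τ)
    (K δ : ℝ) (n : ℕ) : MeasurableSet[ℱ (τ n)] (smallPaths M τ K δ n) := by
  refine MeasurableSet.inter ?_ (measurableSet_smallIncrements hM hτ δ n)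
  have : {ω | ∀ i ≤ n, |M (τ i) ω - M (τ 0) ω| ≤ K}
      = ⋂ i ∈ Finset.range (n + 1), {ω | |M (τ i) ω - M (τ 0) ω| ≤ K} := by
    ext ω; simp
  rw [this]
  refine Finset.measurableSet_biInter _ fun i hi => ?_
  have hi' := Finset.mem_range.1 hi
  have h1 := (hM.stronglyAdapted (τ i)).mono (ℱ.mono (hτ (show i ≤ n by omega)))
  have h2 := (hM.stronglyAdapted (τ 0)).mono (ℱ.mono (hτ (Nat.zero_le n)))
  exact (h1.sub h2).norm.measurable measurableSet_Iic

variable [IsProbabilityMeasure P]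

theorem integral_mul_martingale_sub (hM : Martingale M ℱ P) {s t : ι} (hst : s ≤ t) {ψ : Ω → ℝ}
    (hψ : StronglyMeasurable[ℱ s] ψ) (hint : Integrable (fun ω => ψ ω * (M t ω - M s ω)) P) :
    ∫ ω, ψ ω * (M t ω - M s ω) ∂P = 0 := by
  have h1 : P[fun ω => ψ ω * (M t ω - M s ω)|ℱ s] =ᵐ[P] ψ * P[M t - M s|ℱ s] :=
    condExp_mul_of_stronglyMeasurable_left hψ hint ((hM.integrable t).sub (hM.integrable s))
  have h2 : P[M t - M s|ℱ s] =ᵐ[P] 0 := by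
    filter_upwards [condExp_sub (hM.integrable t) (hM.integrable s) (ℱ s),
      hM.condExp_ae_eq hst, hM.condExp_ae_eq le_rfl] with ω h3 h4 h5
    rw [h3, Pi.sub_apply, h4, h5, sub_self, Pi.zero_apply]
  rw [← integral_condExp (ℱ.le s), integral_congr_ae (g := fun _ => 0)]
  · simp
  · filter_upwards [h1, h2] with ω h3 h4
    rw [h3, Pi.mul_apply, h4, Pi.zero_apply, mul_zero]

theorem memLp_two_of_martingale_sq_sub (hM : Martingale M ℱ P)
    (hQ : Martingale (fun t ω => M t ω ^ 2 - Q t) ℱ P) (t : ι) : MemLp (M t) 2 P := by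
  rw [memLp_two_iff_integrable_sq (hM.integrable t).aestronglyMeasurable]
  exact ((hQ.integrable t).add (integrable_const (Q t))).congr
    (Eventually.of_forall fun ω => by simp)

/-- The squared increment equals the increment of `M² - Q`, minus `2 M_s (M_t - M_s)`, plus `Q_t -
Q_s`. The first two have mean zero against a bounded `ℱ s`-measurable weight. -/
theorem integral_mul_martingale_sub_sq (hM : Martingale M ℱ P)
    (hQ : Martingale (fun t ω => M t ω ^ 2 - Q t) ℱ P) {s t : ι} (hst : s ≤ t) {φ : Ω → ℝ}
    (hφ : StronglyMeasurable[ℱ s] φ) {B : ℝ} (hB : ∀ ω, |φ ω| ≤ B) :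
    ∫ ω, φ ω * (M t ω - M s ω) ^ 2 ∂P = (Q t - Q s) * ∫ ω, φ ω ∂P := by
  have hL := memLp_two_of_martingale_sq_sub hM hQ
  have hφm : AEStronglyMeasurable φ P := (hφ.mono (ℱ.le s)).aestronglyMeasurable
  have hφb : ∀ᵐ ω ∂P, ‖φ ω‖ ≤ B := Eventually.of_forall hB
  have hφi : Integrable φ P := Integrable.of_bound hφm B hφb
  have i1 : Integrable (fun ω => φ ω * ((M t ω ^ 2 - Q t) - (M s ω ^ 2 - Q s))) P :=
    ((hQ.integrable t).sub (hQ.integrable s)).bdd_mul hφm hφb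
  have i2 : Integrable (fun ω => (φ ω * M s ω) * (M t ω - M s ω)) P := by
    have : Integrable (fun ω => φ ω * (M s ω * (M t ω - M s ω))) P :=
      ((hL s).integrable_mul ((hL t).sub (hL s))).bdd_mul hφm hφb
    simpa only [mul_assoc] using this
  have z1 := integral_mul_martingale_sub hQ hst hφ i1
  have z2 := integral_mul_martingale_sub hM hst (hφ.mul (hM.stronglyAdapted s)) i2
  have e : ∀ ω, φ ω * (M t ω - M s ω) ^ 2 = φ ω * ((M t ω ^ 2 - Q t) - (M s ω ^ 2 - Q s))
      - 2 * ((φ ω * M s ω) * (M t ω - M s ω)) + (Q t - Q s) * φ ω := fun ω => by ring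
  have i3 : Integrable (fun ω => φ ω * ((M t ω ^ 2 - Q t) - (M s ω ^ 2 - Q s))
      - 2 * ((φ ω * M s ω) * (M t ω - M s ω))) P := i1.sub (i2.const_mul 2)
  simp_rw [e]
  rw [integral_add i3 (hφi.const_mul _), integral_sub i1 (i2.const_mul 2), integral_const_mul,
    integral_const_mul, z1]
  have z2' : ∫ ω, (φ ω * M s ω) * (M t ω - M s ω) ∂P = 0 := z2
  rw [z2']
  ring

theorem integral_martingale_sub_sq (hM : Martingale M ℱ P)
    (hQ : Martingale (fun t ω => M t ω ^ 2 - Q t) ℱ P) {s t : ι} (hst : s ≤ t) :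
    ∫ ω, (M t ω - M s ω) ^ 2 ∂P = Q t - Q s := by
  simpa using integral_mul_martingale_sub_sq hM hQ hst (φ := fun _ => 1)
    stronglyMeasurable_const (B := 1) (by simp)

/-- Expectation of the one-step inequality, summed: the cubic term has mean zero, the quadratic one
contributes at most `6 n v²`, `d²` has mean `v`, and the charges for large increments add up to the
probability that one has occurred. -/
theorem integral_indicator_smallPaths_le (hM : Martingale M ℱ P)
    (hQ : Martingale (fun t ω => M t ω ^ 2 - Q t) ℱ P) {τ : ℕ → ι} (hτ : Monotone τ) {N : ℕ} {v : ℝ}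
    (hv0 : 0 ≤ v) (hv : ∀ i < N, Q (τ (i + 1)) - Q (τ i) = v) {K δ η : ℝ} (hK : 0 ≤ K)
    (hδ : 0 ≤ δ) (hη : 0 < η) (n : ℕ) (hn : n ≤ N) :
    ∫ ω, (smallPaths M τ K δ n).indicator (fun ω => (M (τ n) ω - M (τ 0) ω) ^ 4) ω ∂P
      ≤ 6 * (n * v) ^ 2 + (4 * K * δ + δ ^ 2 + 2 * K ^ 3 * η) * (n * v)
        + 2 * K ^ 3 / η * (1 - P.real (smallIncrements M τ δ n)) := by
  induction n with
  | zero =>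
    have h1 : P.real (smallIncrements M τ δ 0) = 1 := by simp [smallIncrements]
    rw [h1]
    simp
  | succ n ih =>
    have hL := memLp_two_of_martingale_sq_sub hM hQ
    have hle : τ n ≤ τ (n + 1) := hτ (Nat.le_succ n)
    have hQn : ∀ j ≤ N, Q (τ j) - Q (τ 0) = j * v := fun j hj => by
      induction j with
      | zero => simp
      | succ j ihj =>
        have h1 := hv j (by omega)
        have h2 := ihj (by omega)
        push_cast; linarith
    have hsm : ∀ k : ℕ, StronglyMeasurable[ℱ (τ n)]
        ((smallPaths M τ K δ n).indicator fun ω => (M (τ n) ω - M (τ 0) ω) ^ k) := fun k =>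
      (((hM.stronglyAdapted (τ n)).sub ((hM.stronglyAdapted (τ 0)).mono
        (ℱ.mono (hτ (Nat.zero_le n))))).pow k).indicator (measurableSet_smallPaths hM hτ K δ n)
    have hbi : ∀ k j : ℕ, Integrable
        ((smallPaths M τ K δ j).indicator fun ω => (M (τ j) ω - M (τ 0) ω) ^ k) P := fun k j => by
      refine Integrable.of_bound ?_ (K ^ k)
        (Eventually.of_forall fun ω => abs_indicator_smallPaths_le hK j k ω)
      exact ((((hM.stronglyAdapted (τ j)).sub ((hM.stronglyAdapted (τ 0)).mono
        (ℱ.mono (hτ (Nat.zero_le j))))).pow k).indicator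
        (measurableSet_smallPaths hM hτ K δ j)).mono (ℱ.le _) |>.aestronglyMeasurable
    have hD2 : Integrable (fun ω => (M (τ (n + 1)) ω - M (τ n) ω) ^ 2) P :=
      ((hL _).sub (hL _)).integrable_sq
    have i2 : Integrable (fun ω =>
        (smallPaths M τ K δ n).indicator (fun ω => (M (τ n) ω - M (τ 0) ω) ^ 3) ω
          * (M (τ (n + 1)) ω - M (τ n) ω)) P :=
      ((hM.integrable _).sub (hM.integrable _)).bdd_mul (hbi 3 n).aestronglyMeasurable
        (Eventually.of_forall fun ω => abs_indicator_smallPaths_le hK n 3 ω)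
    have i3 : Integrable (fun ω =>
        (smallPaths M τ K δ n).indicator (fun ω => (M (τ n) ω - M (τ 0) ω) ^ 2) ω
          * (M (τ (n + 1)) ω - M (τ n) ω) ^ 2) P :=
      hD2.bdd_mul (hbi 2 n).aestronglyMeasurable
        (Eventually.of_forall fun ω => abs_indicator_smallPaths_le hK n 2 ω)
    have hms : ∀ j, MeasurableSet (smallIncrements M τ δ j) := fun j =>
      ℱ.le _ _ (measurableSet_smallIncrements hM hτ δ j)
    have i5 : ∀ j, Integrable ((smallIncrements M τ δ j).indicator fun _ => (1 : ℝ)) P := fun j =>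
      (integrable_const _).indicator (hms j)
    have z2 := integral_mul_martingale_sub hM hle (hsm 3) i2
    have z3 := integral_mul_martingale_sub_sq hM hQ hle (hsm 2)
      (fun ω => abs_indicator_smallPaths_le hK n 2 ω)
    rw [hv n hn] at z3
    have z4 := integral_martingale_sub_sq hM hQ hle
    rw [hv n hn] at z4
    have z3' : ∫ ω, (smallPaths M τ K δ n).indicator (fun ω => (M (τ n) ω - M (τ 0) ω) ^ 2) ω ∂P
        ≤ n * v := by
      rw [← hQn n (by omega), ← integral_martingale_sub_sq hM hQ (hτ (Nat.zero_le n))]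
      refine integral_mono (hbi 2 n) ((hL _).sub (hL _)).integrable_sq fun ω => ?_
      exact indicator_le_self' (fun _ _ => sq_nonneg _) ω
    have j1 := (hbi 4 n).add (i2.const_mul 4)
    have j2 := j1.add (i3.const_mul 6)
    have j3 := j2.add (hD2.const_mul (4 * K * δ + δ ^ 2 + 2 * K ^ 3 * η))
    have j4 := ((i5 n).sub (i5 (n + 1))).const_mul (2 * K ^ 3 / η)
    have hint := integral_mono (hbi 4 (n + 1)) (j3.add j4)
      (fun ω => indicator_smallPaths_succ_le hK hδ hη n ω)
    rw [integral_add' j3 j4, integral_add' j2 (hD2.const_mul _), integral_add' j1 (i3.const_mul 6),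
      integral_add' (hbi 4 n) (i2.const_mul 4), integral_const_mul, integral_const_mul,
      integral_const_mul, integral_const_mul] at hint
    simp only [Pi.sub_apply] at hint
    rw [integral_sub (i5 n) (i5 (n + 1)), integral_indicator_const _ (hms n),
      integral_indicator_const _ (hms (n + 1)), z2, z3, z4] at hint
    have := ih (by omega)
    simp only [smul_eq_mul, mul_one] at hint
    have h6 : v * ∫ ω, (smallPaths M τ K δ n).indicator
        (fun ω => (M (τ n) ω - M (τ 0) ω) ^ 2) ω ∂P ≤ v * (n * v) := by gcongr
    push_cast
    have h7 : 0 ≤ v ^ 2 * n := by positivity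
    -- The main term closes because `6 n² + 6 n ≤ 6 (n + 1)²`.
    nlinarith [sq_nonneg v]

end Martingale

/-- The partition of `[s, t]` into `N + 1` intervals of equal length. -/
noncomputable def uniformPartition (s t : ℝ) (N i : ℕ) : ℝ :=
  s + min ((i : ℝ) / (N + 1)) 1 * (t - s)

theorem uniformPartition_mem {s t : ℝ} (hst : s ≤ t) (N i : ℕ) :
    uniformPartition s t N i ∈ Icc s t := by
  have h0 : 0 ≤ min ((i : ℝ) / (N + 1)) 1 := le_min (by positivity) zero_le_one
  have h1 : min ((i : ℝ) / (N + 1)) 1 ≤ 1 := min_le_right _ _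
  have := sub_nonneg.2 hst
  constructor
  · simp only [uniformPartition]; nlinarith
  · simp only [uniformPartition]; nlinarith

theorem uniformPartition_mono {s t : ℝ} (hst : s ≤ t) (N : ℕ) :
    Monotone (uniformPartition s t N) := fun i j hij => by
  have := sub_nonneg.2 hst
  simp only [uniformPartition]
  gcongr

theorem uniformPartition_zero (s t : ℝ) (N : ℕ) : uniformPartition s t N 0 = s := by
  simp [uniformPartition]

theorem uniformPartition_last (s t : ℝ) (N : ℕ) : uniformPartition s t N (N + 1) = t := by
  have : (N : ℝ) + 1 ≠ 0 := by positivity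
  simp [uniformPartition, this]

theorem uniformPartition_succ_sub (s t : ℝ) {N i : ℕ} (hi : i < N + 1) :
    uniformPartition s t N (i + 1) - uniformPartition s t N i = (t - s) / (N + 1) := by
  have h1 : ((i : ℝ) + 1) / (N + 1) ≤ 1 := by
    rw [div_le_one (by positivity)]; exact_mod_cast hi
  have h2 : (i : ℝ) / (N + 1) ≤ 1 := le_trans (by gcongr; linarith) h1
  simp only [uniformPartition]
  push_cast
  rw [min_eq_left h1, min_eq_left h2]
  ring

/-- On a continuous path, the increments along fine partitions are small. -/
theorem eventually_increments_le {f : ℝ → ℝ} {s t : ℝ} (hst : s ≤ t) (hf : ContinuousOn f (Icc s t))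
    {δ : ℝ} (hδ : 0 < δ) :
    ∀ᶠ N : ℕ in atTop, ∀ i < N + 1,
      |f (uniformPartition s t N (i + 1)) - f (uniformPartition s t N i)| ≤ δ := by
  have huc := isCompact_Icc.uniformContinuousOn_of_continuous hf
  obtain ⟨ρ, hρ, h⟩ := Metric.uniformContinuousOn_iff.1 huc δ hδ
  have hlim : Tendsto (fun N : ℕ => (t - s) / ((N : ℝ) + 1)) atTop (𝓝 0) :=
    tendsto_const_nhds.div_atTop
      (tendsto_atTop_add_const_right _ _ tendsto_natCast_atTop_atTop)
  filter_upwards [hlim.eventually (gt_mem_nhds hρ)] with N hN i hi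
  have := h _ (uniformPartition_mem hst N (i + 1)) _ (uniformPartition_mem hst N i) (by
    rw [Real.dist_eq, uniformPartition_succ_sub s t hi, abs_of_nonneg]
    · exact hN
    · exact div_nonneg (sub_nonneg.2 hst) (by positivity))
  exact this.le

namespace StochasticBurgers

variable {Ω : Type*} [MeasurableSpace Ω]

/-- The fourth moment bound for a continuous martingale whose quadratic variation is linear in
time. -/
theorem IsContMartingaleWithQV.lintegral_pow_four_le {P : Measure Ω} [IsProbabilityMeasure P]
    {T : ℝ} {M : ℝ → Ω → ℝ} {c : ℝ} (hc : 0 ≤ c)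
    (hM : IsContMartingaleWithQV P T M fun t => c * t) {s t : ℝ} (hs : s ∈ Icc 0 T)
    (ht : t ∈ Icc 0 T) (hst : s < t) :
    ∫⁻ ω, ENNReal.ofReal (|M t ω - M s ω| ^ 4) ∂P
      ≤ ENNReal.ofReal (6 * c ^ 2 * (t - s) ^ 2) := by
  obtain ⟨ℱ, hM1, hcont, hQ⟩ := hM
  set M' : Icc (0 : ℝ) T → Ω → ℝ := fun t => M t with hM'
  have hsub : Icc s t ⊆ Icc 0 T := Icc_subset_Icc hs.1 ht.2
  set τ : ℕ → ℕ → Icc (0 : ℝ) T := fun N i =>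
    ⟨uniformPartition s t N i, hsub (uniformPartition_mem hst.le N i)⟩ with hτ
  have hτmono : ∀ N, Monotone (τ N) := fun N i j hij => uniformPartition_mono hst.le N hij
  have hτ0 : ∀ N, M' (τ N 0) = M s := fun N => by simp only [hM', hτ, uniformPartition_zero]
  have hτN : ∀ N, M' (τ N (N + 1)) = M t := fun N => by
    simp only [hM', hτ, uniformPartition_last]
  have hMm : ∀ r ∈ Icc 0 T, Measurable (M r) := fun r hr =>
    ((hM1.stronglyAdapted ⟨r, hr⟩).mono (ℱ.le _)).measurable
  set V : ℝ := c * (t - s) with hV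
  have hV0 : 0 ≤ V := mul_nonneg hc (by linarith)
  set X : Ω → ℝ := fun ω => M t ω - M s ω with hX
  have hXm : Measurable X := (hMm t ht).sub (hMm s hs)
  -- The truncation is uniform over all partitions, so it does not change as the mesh is refined.
  -- The limits are taken in the order `N → ∞`, `δ → 0`, `K → ∞`.
  set A : ℕ → Set Ω := fun K => {ω | ∀ N i, |M' (τ N i) ω - M s ω| ≤ K} with hA
  have hAm : ∀ K, MeasurableSet (A K) := fun K => by
    have : A K = ⋂ (N : ℕ) (i : ℕ), {ω | |M' (τ N i) ω - M s ω| ≤ K} := by ext ω; simp [hA]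
    rw [this]
    exact MeasurableSet.iInter fun N => MeasurableSet.iInter fun i =>
      ((hMm _ (τ N i).2).sub (hMm s hs)).norm measurableSet_Iic
  have hAX : ∀ K, ∀ ω ∈ A K, |X ω| ≤ K := fun K ω hω => by
    -- For `N = 0` there is a single interval, whose right end, at index 1, is `t`.
    have := hω 0 1
    rwa [show M' (τ 0 1) = M t from hτN 0] at this
  have hAi : ∀ K, Integrable ((A K).indicator fun ω => X ω ^ 4) P := fun K => by
    refine Integrable.of_bound ((hXm.pow_const 4).indicator (hAm K)).aestronglyMeasurable
      ((K : ℝ) ^ 4) (Eventually.of_forall fun ω => ?_)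
    by_cases h : ω ∈ A K
    · rw [indicator_of_mem h, norm_pow]
      exact pow_le_pow_left₀ (norm_nonneg _) (hAX K ω h) 4
    · rw [indicator_of_notMem h, norm_zero]; positivity
  have hstep : ∀ (K : ℕ) (δ : ℝ), 0 < δ → ∀ N : ℕ, ∫ ω, (A K).indicator (fun ω => X ω ^ 4) ω ∂P
      ≤ 6 * V ^ 2 + (4 * K * δ + δ ^ 2 + 2 * K ^ 3 * δ) * V
        + (2 * K ^ 3 / δ + K ^ 4) * (1 - P.real (smallIncrements M' (τ N) δ (N + 1))) := by
    intro K δ hδ N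
    -- Here `η = δ`, so that every error proportional to `V` vanishes as `δ → 0`.
    have h := integral_indicator_smallPaths_le (Q := fun t : Icc (0 : ℝ) T => c * t)
      hM1 hQ (hτmono N) (N := N + 1) (v := V / (N + 1))
      (by positivity) (fun i hi => by
        rw [← mul_sub, show ((τ N (i + 1) : ℝ) - τ N i) = (t - s) / (N + 1) from
          uniformPartition_succ_sub s t hi, hV, mul_div_assoc]) (K := K) (Nat.cast_nonneg K) hδ.le
      hδ (N + 1) le_rfl
    have e : ((N + 1 : ℕ) : ℝ) * (V / (N + 1)) = V := by push_cast; field_simp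
    rw [e] at h
    have hms : MeasurableSet (smallIncrements M' (τ N) δ (N + 1)) :=
      ℱ.le _ _ (measurableSet_smallIncrements hM1 (hτmono N) δ (N + 1))
    have hms' : MeasurableSet (smallPaths M' (τ N) K δ (N + 1)) :=
      ℱ.le _ _ (measurableSet_smallPaths hM1 (hτmono N) K δ (N + 1))
    have hcompl : P.real (smallIncrements M' (τ N) δ (N + 1))ᶜ
        = 1 - P.real (smallIncrements M' (τ N) δ (N + 1)) := probReal_compl_eq_one_sub hms
    have hEX : ∀ ω, M' (τ N (N + 1)) ω - M' (τ N 0) ω = X ω := fun ω => by rw [hτN, hτ0]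
    simp_rw [hEX] at h
    have hsi : Integrable ((smallPaths M' (τ N) K δ (N + 1)).indicator fun ω => X ω ^ 4) P := by
      refine Integrable.of_bound ((hXm.pow_const 4).indicator hms').aestronglyMeasurable
        ((K : ℝ) ^ 4) (Eventually.of_forall fun ω => ?_)
      have := abs_indicator_smallPaths_le (M := M') (τ := τ N) (δ := δ) (Nat.cast_nonneg K)
        (N + 1) 4 ω
      simp_rw [hEX] at this
      exact this
    -- A path in `A K` is a small path or has a large increment, and in the latter case its fourth
    -- power is still at most `K ^ 4`.
    have hle : ∫ ω, (A K).indicator (fun ω => X ω ^ 4) ω ∂P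
        ≤ ∫ ω, (smallPaths M' (τ N) K δ (N + 1)).indicator (fun ω => X ω ^ 4) ω ∂P
          + P.real (smallIncrements M' (τ N) δ (N + 1))ᶜ * (K : ℝ) ^ 4 := by
      have hci : Integrable ((smallIncrements M' (τ N) δ (N + 1))ᶜ.indicator
          fun _ => (K : ℝ) ^ 4) P := (integrable_const _).indicator hms.compl
      rw [← smul_eq_mul, ← integral_indicator_const _ hms.compl, ← integral_add hsi hci]
      refine integral_mono (hAi K) (hsi.add hci) fun ω => ?_
      have hX4 : 0 ≤ X ω ^ 4 := by positivity
      have n1 : 0 ≤ (smallPaths M' (τ N) K δ (N + 1)).indicator (fun ω => X ω ^ 4) ω :=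
        indicator_nonneg (fun _ _ => by positivity) ω
      have n2 : 0 ≤ (smallIncrements M' (τ N) δ (N + 1))ᶜ.indicator (fun _ => (K : ℝ) ^ 4) ω :=
        indicator_nonneg (fun _ _ => by positivity) ω
      by_cases hω : ω ∈ A K
      · simp only [indicator_of_mem hω]
        by_cases hb : ω ∈ smallIncrements M' (τ N) δ (N + 1)
        · have hg : ω ∈ smallPaths M' (τ N) K δ (N + 1) :=
            ⟨fun i _ => by rw [hτ0]; exact hω N i, hb⟩
          rw [indicator_of_mem hg]
          linarith
        · rw [indicator_of_mem (show ω ∈ (smallIncrements M' (τ N) δ (N + 1))ᶜ from hb)]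
          have : X ω ^ 4 ≤ (K : ℝ) ^ 4 := by
            have := pow_le_pow_left₀ (abs_nonneg _) (hAX K ω hω) 4
            rwa [Even.pow_abs (by decide)] at this
          linarith
      · simp only [indicator_of_notMem hω]
        linarith
    rw [hcompl] at hle
    linarith
  -- Path continuity enters here: almost surely, large increments disappear on fine partitions.
  have hP1 : ∀ δ : ℝ, 0 < δ → Tendsto
      (fun N => P.real (smallIncrements M' (τ N) δ (N + 1))) atTop (𝓝 1) := fun δ hδ => by
    have hms : ∀ N, MeasurableSet (smallIncrements M' (τ N) δ (N + 1)) := fun N =>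
      ℱ.le _ _ (measurableSet_smallIncrements hM1 (hτmono N) δ (N + 1))
    have h1 : Tendsto (fun N => ∫ ω,
        (smallIncrements M' (τ N) δ (N + 1)).indicator (fun _ => (1 : ℝ)) ω ∂P) atTop
        (𝓝 (∫ _, (1 : ℝ) ∂P)) := by
      refine tendsto_integral_of_dominated_convergence (fun _ => (1 : ℝ))
        (fun N => (measurable_const.indicator (hms N)).aestronglyMeasurable)
        (integrable_const _) (fun N => Eventually.of_forall fun ω => ?_) ?_
      · exact (norm_indicator_le_norm_self _ _).trans (by simp)
      · filter_upwards [hcont] with ω hω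
        refine tendsto_const_nhds.congr' ?_
        filter_upwards [eventually_increments_le hst.le (hω.mono hsub) hδ] with N hN
        rw [indicator_of_mem]
        exact hN
    simpa [integral_indicator_const _ (hms _)] using h1
  have hKbound : ∀ K : ℕ, ∫ ω, (A K).indicator (fun ω => X ω ^ 4) ω ∂P ≤ 6 * V ^ 2 := by
    intro K
    have hδ : ∀ δ : ℝ, 0 < δ → ∫ ω, (A K).indicator (fun ω => X ω ^ 4) ω ∂P
        ≤ 6 * V ^ 2 + (4 * K * δ + δ ^ 2 + 2 * K ^ 3 * δ) * V := fun δ hδ => by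
      have hlim := (((tendsto_const_nhds (x := (1 : ℝ))).sub (hP1 δ hδ)).const_mul
        (2 * (K : ℝ) ^ 3 / δ + K ^ 4)).const_add
        (6 * V ^ 2 + (4 * K * δ + δ ^ 2 + 2 * K ^ 3 * δ) * V)
      rw [sub_self, mul_zero, add_zero] at hlim
      exact ge_of_tendsto' hlim (hstep K δ hδ)
    have hlim : Tendsto (fun δ : ℝ => 6 * V ^ 2 + (4 * K * δ + δ ^ 2 + 2 * K ^ 3 * δ) * V)
        (𝓝[>] 0) (𝓝 (6 * V ^ 2 + (4 * K * 0 + 0 ^ 2 + 2 * K ^ 3 * 0) * V)) :=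
      (Continuous.tendsto (by fun_prop) 0).mono_left nhdsWithin_le_nhds
    have := ge_of_tendsto hlim (eventually_nhdsWithin_of_forall fun δ hδ' => hδ δ hδ')
    simpa using this
  have hmono : Tendsto (fun K => ∫⁻ ω, ENNReal.ofReal ((A K).indicator (fun ω => X ω ^ 4) ω) ∂P)
      atTop (𝓝 (∫⁻ ω, ENNReal.ofReal (|M t ω - M s ω| ^ 4) ∂P)) := by
    refine lintegral_tendsto_of_tendsto_of_monotone
      (fun K => (((hXm.pow_const 4).indicator (hAm K)).ennreal_ofReal).aemeasurable)
      (Eventually.of_forall fun ω K L hKL => ?_) ?_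
    · refine ENNReal.ofReal_le_ofReal (indicator_le_indicator_of_subset (fun ω hω N i => ?_)
        (fun _ => by positivity) ω)
      exact (hω N i).trans (by exact_mod_cast hKL)
    · filter_upwards [hcont] with ω hω
      have hb : ∃ B : ℝ, ∀ r ∈ Icc s t, |M r ω - M s ω| ≤ B := by
        have := isCompact_Icc.exists_bound_of_continuousOn
          ((hω.mono hsub).sub (continuousOn_const (c := M s ω)))
        simpa using this
      obtain ⟨B, hB⟩ := hb
      obtain ⟨K₀, hK₀⟩ := exists_nat_ge B
      refine tendsto_const_nhds.congr' ?_
      filter_upwards [eventually_ge_atTop K₀] with K hK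
      have hω : ω ∈ A K := fun N i => by
        refine (hB _ (uniformPartition_mem hst.le N i)).trans (hK₀.trans ?_)
        exact_mod_cast hK
      rw [indicator_of_mem hω, Even.pow_abs (by decide)]
  refine le_of_tendsto' hmono fun K => ?_
  rw [← ofReal_integral_eq_lintegral_ofReal (hAi K)
    (Eventually.of_forall fun ω => indicator_nonneg (fun _ _ => by positivity) ω)]
  refine ENNReal.ofReal_le_ofReal ((hKbound K).trans_eq ?_)
  rw [hV]; ring

end StochasticBurgers

/-! ### Increments of the nonlinear term. -/

namespace StochasticBurgers

variable {Ω : Type*} [MeasurableSpace Ω]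

theorem deriv_eq_derivCLM (u : 𝓢(ℝ, ℝ)) : deriv u = SchwartzMap.derivCLM ℝ ℝ u := by
  ext x; simp

theorem integral_deriv_schwartz (u : 𝓢(ℝ, ℝ)) : ∫ x, deriv u x = 0 := by
  refine integral_eq_zero_of_hasDerivAt_of_integrable
    (fun x => u.differentiable.differentiableAt.hasDerivAt) ?_ u.integrable
  rw [deriv_eq_derivCLM]
  exact (SchwartzMap.derivCLM ℝ ℝ u).integrable

theorem energy_nonneg (u : 𝓢(ℝ, ℝ)) : 0 ≤ energy u := integral_nonneg fun _ => sq_nonneg _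

theorem IsWhiteNoise.lintegral_sq {P : Measure Ω} {χ : ℝ} (hχ : 0 ≤ χ) {W : Ω → TempDist}
    (hW : IsWhiteNoise P χ W) (u : 𝓢(ℝ, ℝ)) :
    ∫⁻ ω, ENNReal.ofReal (W ω u ^ 2) ∂P = ENNReal.ofReal (χ * ∫ x, u x ^ 2) := by
  set v := (χ * ∫ x, u x ^ 2).toNNReal with hv
  have h1 : ∫⁻ ω, ENNReal.ofReal (W ω u ^ 2) ∂P
      = ∫⁻ x, ENNReal.ofReal (x ^ 2) ∂(gaussianReal 0 v) :=
    (hW u).lintegral_comp (f := fun x : ℝ => ENNReal.ofReal (x ^ 2)) (by fun_prop)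
  have hi : Integrable (fun x : ℝ => x ^ 2) (gaussianReal 0 v) :=
    (memLp_id_gaussianReal (μ := 0) (v := v) 2).integrable_sq
  rw [h1, ← ofReal_integral_eq_lintegral_ofReal hi (Eventually.of_forall fun x => sq_nonneg x)]
  have h2 := variance_fun_id_gaussianReal (μ := 0) (v := v)
  rw [variance_eq_integral (by fun_prop), integral_id_gaussianReal] at h2
  simp only [sub_zero] at h2
  rw [h2, hv, Real.coe_toNNReal']
  rw [max_eq_left (mul_nonneg hχ (integral_nonneg fun _ => sq_nonneg _))]

section QuadInt

variable {P : Measure Ω} {χ T : ℝ} {Y : ℝ → Ω → TempDist} {Z : ℝ → ℝ → ℝ → Ω → ℝ}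

theorem IsAveragedField.measurable_integral (hZ : IsAveragedField P T Y Z) {ε : ℝ} (hε : 0 < ε)
    (u : 𝓢(ℝ, ℝ)) :
    Measurable fun p : Icc (0 : ℝ) T × Ω => ∫ x, Z ε p.1 x p.2 ^ 2 * deriv u x := by
  have hd : Measurable (deriv u) := by
    rw [deriv_eq_derivCLM]; exact (SchwartzMap.derivCLM ℝ ℝ u).continuous.measurable
  have h : Measurable fun q : (Icc (0 : ℝ) T × Ω) × ℝ =>
      Z ε q.1.1 q.2 q.1.2 ^ 2 * deriv u q.2 := by
    have h1 : Measurable fun q : (Icc (0 : ℝ) T × Ω) × ℝ => Z ε q.1.1 q.2 q.1.2 :=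
      (hZ.measurable ε hε).comp ((measurable_fst.comp measurable_fst).prodMk
        (measurable_snd.prodMk (measurable_snd.comp measurable_fst)))
    exact (h1.pow_const 2).mul (hd.comp measurable_snd)
  exact h.stronglyMeasurable.integral_prod_right'.measurable

theorem IsAveragedField.aestronglyMeasurable_quadInt (hT : 0 ≤ T) (hZ : IsAveragedField P T Y Z)
    (u : 𝓢(ℝ, ℝ)) {ε : ℝ} (hε : 0 < ε) {s t : ℝ} (hs : s ∈ Icc 0 T) (ht : t ∈ Icc 0 T) :
    AEStronglyMeasurable (quadInt Z ε s t u) P :=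
  (measurable_intervalIntegral hT (hZ.measurable_integral hε u) hs ht).aestronglyMeasurable

variable [IsProbabilityMeasure P]

/-- The second moment of `∫ Y_r(i_ε(x))² ∇u(x) dx` is of order `ε⁻¹`. -/
theorem IsAveragedField.exists_lintegral_sq_integral_le (hχ : 0 ≤ χ) (hY : IsStationary P χ T Y)
    (hZ : IsAveragedField P T Y Z) (u : 𝓢(ℝ, ℝ)) :
    ∃ C : ℝ, 0 ≤ C ∧ ∀ ε : ℝ, 0 < ε → ∀ r ∈ Icc 0 T,
      ∫⁻ ω, ENNReal.ofReal ((∫ x, Z ε r x ω ^ 2 * deriv u x) ^ 2) ∂P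
        ≤ ENNReal.ofReal (C / ε) := by
  set w := SchwartzMap.derivCLM ℝ ℝ u with hw
  have hS : ∀ x, |w x| ≤ SchwartzMap.seminorm ℝ 0 0 w := fun x => w.norm_le_seminorm ℝ x
  refine ⟨4 * χ ^ 2 * SchwartzMap.seminorm ℝ 0 0 w * ∫ x, |w x|, ?_, fun ε hε r hr => ?_⟩
  · have : 0 ≤ SchwartzMap.seminorm ℝ 0 0 w := (abs_nonneg _).trans (hS 0)
    have : 0 ≤ ∫ x, |w x| := integral_nonneg fun _ => abs_nonneg _
    positivity
  · have h0 := integral_deriv_schwartz u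
    rw [deriv_eq_derivCLM, ← hw] at h0 ⊢
    refine (hY r hr).lintegral_sq_integral_le hχ hε (ζ := fun x => Z ε r x) ?_
      (fun x => hZ.isL2Value ε hε r hr x) w.continuous.measurable w.integrable h0 hS
    exact (hZ.measurable ε hε).comp
      (measurable_const.prodMk measurable_id : Measurable fun p : ℝ × Ω =>
        ((⟨r, hr⟩ : Icc (0 : ℝ) T), p))

/-- Additivity over intervals requires the integrand to be integrable in time, which the second
moment bound provides for almost every `ω`. -/
theorem IsAveragedField.ae_quadInt_sub (hχ : 0 ≤ χ) (hT : 0 ≤ T) (hY : IsStationary P χ T Y)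
    (hZ : IsAveragedField P T Y Z) (u : 𝓢(ℝ, ℝ)) {ε : ℝ} (hε : 0 < ε) {s t : ℝ} (hs : s ∈ Icc 0 T)
    (ht : t ∈ Icc 0 T) :
    ∀ᵐ ω ∂P, quadInt Z ε 0 t u ω - quadInt Z ε 0 s u ω = quadInt Z ε s t u ω := by
  obtain ⟨C, -, hC⟩ := hZ.exists_lintegral_sq_integral_le hχ hY u
  filter_upwards [ae_intervalIntegrable_of_second_moment_le hT (hZ.measurable_integral hε u)
    (hC ε hε)] with ω hω
  have hsub : ∀ r ∈ Icc 0 T, IntervalIntegrable (fun r => ∫ x, Z ε r x ω ^ 2 * deriv u x)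
      volume 0 r := fun r hr => hω.mono_set (by
    rw [uIcc_of_le hr.1, uIcc_of_le hT]; exact Icc_subset_Icc_right hr.2)
  exact intervalIntegral.integral_interval_sub_left (hsub t ht) (hsub s hs)

/-- The increments of the nonlinear term, approximated at the scale `ε`. -/
theorem IsNonlinearTerm.eLpNorm_increment_le (hχ : 0 ≤ χ) (hT : 0 ≤ T) (hY : IsStationary P χ T Y)
    (hZ : IsAveragedField P T Y Z) {A : ℝ → Ω → TempDist} (hA : IsNonlinearTerm P T Z A)
    (u : 𝓢(ℝ, ℝ)) {ε : ℝ} (hε : 0 < ε) {s t : ℝ} (hs : s ∈ Icc 0 T) (ht : t ∈ Icc 0 T)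
    {B : ℝ≥0∞} (hB : ∀ δ : ℝ, 0 < δ → δ < ε →
      eLpNorm (fun ω => quadInt Z ε s t u ω - quadInt Z δ s t u ω) 2 P ≤ B) :
    eLpNorm (fun ω => A t ω u - A s ω u) 2 P ≤ eLpNorm (quadInt Z ε s t u) 2 P + B := by
  have h0 : (0 : ℝ) ∈ Icc 0 T := left_mem_Icc.2 hT
  have hAm : ∀ r ∈ Icc 0 T, AEStronglyMeasurable (fun ω => A r ω u) P := fun r hr =>
    (hA.isProcess r hr u).aestronglyMeasurable
  have hQm : ∀ δ, 0 < δ → ∀ a ∈ Icc 0 T, ∀ b ∈ Icc 0 T,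
      AEStronglyMeasurable (quadInt Z δ a b u) P := fun δ hδ a ha b hb =>
    hZ.aestronglyMeasurable_quadInt hT u hδ ha hb
  have hlim : Tendsto (fun δ => eLpNorm (fun ω => quadInt Z δ 0 t u ω - A t ω u) 2 P
      + eLpNorm (fun ω => quadInt Z δ 0 s u ω - A s ω u) 2 P
      + (eLpNorm (quadInt Z ε s t u) 2 P + B)) (𝓝[>] 0)
      (𝓝 (eLpNorm (quadInt Z ε s t u) 2 P + B)) := by
    have := ((hA.tendsto u t ht).add (hA.tendsto u s hs)).add_const
      (eLpNorm (quadInt Z ε s t u) 2 P + B)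
    rwa [add_zero, zero_add] at this
  refine ge_of_tendsto hlim ?_
  filter_upwards [Ioo_mem_nhdsGT hε] with δ hδ
  -- Two errors that vanish as `δ → 0`, plus the integral at scale `δ` written as the one at scale
  -- `ε` minus their difference.
  have e : (fun ω => A t ω u - A s ω u) =ᵐ[P]
      (((fun ω => A t ω u - quadInt Z δ 0 t u ω) + fun ω => quadInt Z δ 0 s u ω - A s ω u)
        + (quadInt Z ε s t u - fun ω => quadInt Z ε s t u ω - quadInt Z δ s t u ω)) := by
    filter_upwards [hZ.ae_quadInt_sub hχ hT hY u hδ.1 hs ht] with ω hω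
    simp only [Pi.add_apply, Pi.sub_apply]
    linarith
  have m1 : AEStronglyMeasurable (fun ω => A t ω u - quadInt Z δ 0 t u ω) P :=
    (hAm t ht).sub (hQm δ hδ.1 0 h0 t ht)
  have m2 : AEStronglyMeasurable (fun ω => quadInt Z δ 0 s u ω - A s ω u) P :=
    (hQm δ hδ.1 0 h0 s hs).sub (hAm s hs)
  have m3 := hQm ε hε s hs t ht
  have m4 : AEStronglyMeasurable (fun ω => quadInt Z ε s t u ω - quadInt Z δ s t u ω) P :=
    m3.sub (hQm δ hδ.1 s hs t ht)
  rw [eLpNorm_congr_ae e]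
  refine (eLpNorm_add_le (m1.add m2) (m3.sub m4) one_le_two).trans ?_
  refine add_le_add ((eLpNorm_add_le m1 m2 one_le_two).trans (add_le_add ?_ le_rfl))
    ((eLpNorm_sub_le m3 m4 one_le_two).trans (add_le_add le_rfl (hB δ hδ.1 hδ.2)))
  exact (eLpNorm_sub_comm _ _ _ _).le

/-- The increments of the nonlinear term have second moments of order `(t - s) ^ (3 / 2)`. -/
theorem IsNonlinearTerm.exists_lintegral_sq_sub_le (hχ : 0 ≤ χ) (hT : 0 < T)
    (hY : IsStationary P χ T Y) (hZ : IsAveragedField P T Y Z) (hE : EnergyEstimate P T Y Z)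
    {A : ℝ → Ω → TempDist} (hA : IsNonlinearTerm P T Z A) (u : 𝓢(ℝ, ℝ)) :
    ∃ C : ℝ, ∀ s ∈ Icc 0 T, ∀ t ∈ Icc 0 T, s < t →
      ∫⁻ ω, ENNReal.ofReal (|A t ω u - A s ω u| ^ 2) ∂P
        ≤ ENNReal.ofReal (C * (t - s) ^ (3 / 2 : ℝ)) := by
  obtain ⟨κ, hκ, -, hκ2⟩ := hE
  obtain ⟨C, hC0, hC⟩ := hZ.exists_lintegral_sq_integral_le hχ hY u
  -- Dividing `√(t - s)` by `b` keeps `ε < 1`, as the energy estimate requires, without changing its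
  -- order.
  set b : ℝ := 1 + √T with hb
  have hb0 : 0 < b := by positivity
  set L : ℝ := max (C * b) (κ / b * energy u) with hL
  have hL0 : 0 ≤ L := le_max_of_le_left (by positivity)
  refine ⟨4 * L, fun s hs t ht hst => ?_⟩
  have hts : 0 < t - s := sub_pos.2 hst
  have hsq : (t - s) ^ (3 / 2 : ℝ) = (t - s) * √(t - s) := by
    rw [Real.sqrt_eq_rpow, ← Real.rpow_one_add' hts.le (by norm_num)]
    norm_num
  have hr0 : 0 < √(t - s) := Real.sqrt_pos.2 hts
  have hrr : √(t - s) * √(t - s) = t - s := Real.mul_self_sqrt hts.le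
  set ε : ℝ := √(t - s) / b with hε
  have hε0 : 0 < ε := by positivity
  have hε1 : ε < 1 := by
    rw [hε, div_lt_one hb0]
    have : √(t - s) ≤ √T := Real.sqrt_le_sqrt (by linarith [hs.1, ht.2])
    linarith
  have h1 : ∫⁻ ω, ENNReal.ofReal (quadInt Z ε s t u ω ^ 2) ∂P
      ≤ ENNReal.ofReal (L * (t - s) ^ (3 / 2 : ℝ)) := by
    refine (lintegral_sq_intervalIntegral_le hT.le (hZ.measurable_integral hε0 u)
      (div_nonneg hC0 hε0.le) (hC ε hε0) hs ht hst.le).trans (ENNReal.ofReal_le_ofReal ?_)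
    have : C / ε * (t - s) ^ 2 = C * b * (t - s) ^ (3 / 2 : ℝ) := by
      rw [hsq, hε]
      field_simp
      nlinarith
    rw [this]
    gcongr
    exact le_max_left _ _
  have h2 : ∀ δ : ℝ, 0 < δ → δ < ε →
      ∫⁻ ω, ENNReal.ofReal ((quadInt Z ε s t u ω - quadInt Z δ s t u ω) ^ 2) ∂P
        ≤ ENNReal.ofReal (L * (t - s) ^ (3 / 2 : ℝ)) := fun δ hδ hδε => by
    refine (hκ2 u δ ε hδ hδε hε1 s hs t ht hst).trans (ENNReal.ofReal_le_ofReal ?_)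
    have : κ * (t - s) * ε * energy u = κ / b * energy u * (t - s) ^ (3 / 2 : ℝ) := by
      rw [hsq, hε]; field_simp
    rw [this]
    gcongr
    exact le_max_right _ _
  set B : ℝ≥0∞ := ENNReal.ofReal (L * (t - s) ^ (3 / 2 : ℝ)) with hB
  have h3 := hA.eLpNorm_increment_le hχ hT.le hY hZ u hε0 hs ht (B := B ^ (1 / 2 : ℝ))
    fun δ hδ hδε => by
      rw [eLpNorm_two_eq_rpow]
      exact ENNReal.rpow_le_rpow (h2 δ hδ hδε) (by norm_num)
  have h4 : eLpNorm (quadInt Z ε s t u) 2 P ≤ B ^ (1 / 2 : ℝ) := by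
    rw [eLpNorm_two_eq_rpow]
    exact ENNReal.rpow_le_rpow h1 (by norm_num)
  simp_rw [sq_abs]
  rw [← eLpNorm_two_sq]
  calc eLpNorm (fun ω => A t ω u - A s ω u) 2 P ^ 2
      ≤ (B ^ (1 / 2 : ℝ) + B ^ (1 / 2 : ℝ)) ^ 2 := by
        gcongr
        exact h3.trans (add_le_add h4 le_rfl)
    _ = 4 * B := by
        rw [← two_mul, mul_pow, ← ENNReal.rpow_natCast (B ^ (1 / 2 : ℝ)), ← ENNReal.rpow_mul]
        norm_num
    _ = ENNReal.ofReal (4 * L * (t - s) ^ (3 / 2 : ℝ)) := by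
        rw [hB, mul_assoc, ENNReal.ofReal_mul (p := 4) (by norm_num), ENNReal.ofReal_ofNat]

end QuadInt

/-! ### The drift, and the sum of the three contributions. -/

section Drift

variable {P : Measure Ω} [IsProbabilityMeasure P] {χ T : ℝ} {Y : ℝ → Ω → TempDist}

theorem ae_holderOnWith_integral (hχ : 0 ≤ χ) (hT : 0 < T) (hYm : IsMeasurableProcess T Y)
    (hY : IsStationary P χ T Y) (u : 𝓢(ℝ, ℝ)) {α : ℝ≥0} (hα : 0 < α) (hα4 : α < 1 / 4) :
    ∀ᵐ ω ∂P, ∃ C : ℝ≥0, HolderOnWith C α (fun t => ∫ s in (0 : ℝ)..t, Y s ω u) (Icc 0 T) := by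
  have hα4' : (α : ℝ) < 1 / 4 := by exact_mod_cast hα4
  have h0 : (0 : ℝ) ∈ Icc 0 T := left_mem_Icc.2 hT.le
  have hK0 : 0 ≤ χ * ∫ x, u x ^ 2 := mul_nonneg hχ (integral_nonneg fun _ => sq_nonneg _)
  have hK : ∀ r ∈ Icc 0 T, ∫⁻ ω, ENNReal.ofReal (Y r ω u ^ 2) ∂P
      ≤ ENNReal.ofReal (χ * ∫ x, u x ^ 2) := fun r hr => ((hY r hr).lintegral_sq hχ u).le
  have hint := ae_intervalIntegrable_of_second_moment_le (F := fun r ω => Y r ω u) hT.le (hYm u) hK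
  refine ae_holderOnWith_of_moment_le hT
    (fun t ht => (measurable_intervalIntegral hT.le (hYm u) h0 ht).aemeasurable) ?_ (p := 2)
    two_ne_zero (q := 2) (K := χ * ∫ x, u x ^ 2) (fun s hs t ht hst => ?_) hα
    (by push_cast; linarith)
  · filter_upwards [hint] with ω hω
    have := intervalIntegral.continuousOn_primitive_interval' hω left_mem_uIcc
    rwa [uIcc_of_le hT.le] at this
  · simp_rw [sq_abs]
    rw [Real.rpow_ofNat]
    refine le_trans (lintegral_mono_ae ?_)
      (lintegral_sq_intervalIntegral_le hT.le (hYm u) hK0 hK hs ht hst.le)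
    filter_upwards [hint] with ω hω
    have hsub : ∀ r ∈ Icc 0 T, IntervalIntegrable (fun r => Y r ω u) volume 0 r := fun r hr =>
      hω.mono_set (by rw [uIcc_of_le hr.1, uIcc_of_le hT.le]; exact Icc_subset_Icc_right hr.2)
    rw [intervalIntegral.integral_interval_sub_left (hsub t ht) (hsub s hs)]

end Drift

theorem IsStationaryEnergySolution.ae_holderOnWith {P : Measure Ω} [IsProbabilityMeasure P]
    {D χ lam T : ℝ} (hD : 0 < D) (hχ : 0 < χ) (hT : 0 < T) {Y : ℝ → Ω → TempDist}
    (hY : IsStationaryEnergySolution P D χ lam T Y) (u : 𝓢(ℝ, ℝ)) {α : ℝ≥0} (hα : 0 < α)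
    (hα4 : α < 1 / 4) :
    ∀ᵐ ω ∂P, ∃ C : ℝ≥0, HolderOnWith C α (fun t => Y t ω u) (Icc 0 T) := by
  have hα4' : (α : ℝ) < 1 / 4 := by exact_mod_cast hα4
  obtain ⟨Z, A, hZ, hE, hA, hM⟩ := hY.exists_fields
  have hdrift := ae_holderOnWith_integral hχ.le hT hY.isMeasurableProcess hY.isStationary (lap u)
    hα hα4
  have hnonlin : ∀ᵐ ω ∂P, ∃ C : ℝ≥0, HolderOnWith C α (fun t => A t ω u) (Icc 0 T) := by
    obtain ⟨C, hC⟩ := hA.exists_lintegral_sq_sub_le hχ.le hT hY.isStationary hZ hE u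
    refine ae_holderOnWith_of_moment_le hT (fun t ht => (hA.isProcess t ht u).aemeasurable) ?_
      (p := 2) two_ne_zero (q := 3 / 2) hC hα (by push_cast; linarith)
    filter_upwards [hA.continuous] with ω hω
    exact (continuous_eval_const u).comp_continuousOn hω
  obtain ⟨c, hc⟩ : ∃ c, c = 2 * χ * D * energy u := ⟨_, rfl⟩
  have hc0 : 0 ≤ c := by rw [hc]; exact mul_nonneg (by positivity) (energy_nonneg u)
  have hMu := hM u
  rw [show (fun t => 2 * χ * D * t * energy u) = fun t => c * t from
    funext fun t => by rw [hc]; ring] at hMu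
  -- With `p = 4` and `q = 2` the condition `4 α < q - 1` is exactly `α < 1/4`.
  have hmart := ae_holderOnWith_of_moment_le (P := P) hT (p := 4) (q := 2) (K := 6 * c ^ 2)
    (fun t ht => ?_) hMu.choose_spec.2.1 (by norm_num)
    (fun s hs t ht hst => by
      rw [Real.rpow_ofNat]; exact hMu.lintegral_pow_four_le hc0 hs ht hst) hα
    (by push_cast; linarith)
  · filter_upwards [hdrift, hnonlin, hmart] with ω h1 h2 h3
    obtain ⟨C1, h1⟩ := h1
    obtain ⟨C2, h2⟩ := h2
    obtain ⟨C3, h3⟩ := h3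
    refine ⟨C3 + ‖D‖₊ * C1 + ‖lam‖₊ * C2, fun s hs t ht => ?_⟩
    have e : ∀ r, Y r ω u = (Y r ω u - Y 0 ω u - D * (∫ s in (0 : ℝ)..r, Y s ω (lap u))
        - lam * A r ω u) + D * (∫ s in (0 : ℝ)..r, Y s ω (lap u)) + lam * A r ω u + Y 0 ω u :=
      fun r => by ring
    have k1 := h1 s hs t ht
    have k2 := h2 s hs t ht
    have k3 := h3 s hs t ht
    simp only at k1 k2 k3 ⊢
    have hmul : ∀ (d a b : ℝ) (C : ℝ≥0), edist a b ≤ C * edist s t ^ (α : ℝ) →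
        edist (d * a) (d * b) ≤ ‖d‖₊ * C * edist s t ^ (α : ℝ) := fun d a b C h => by
      rw [← smul_eq_mul, ← smul_eq_mul, edist_smul₀, ENNReal.smul_def, smul_eq_mul, mul_assoc]
      gcongr
    rw [e s, e t, edist_add_right, ENNReal.coe_add, ENNReal.coe_add, ENNReal.coe_mul,
      ENNReal.coe_mul, add_mul, add_mul]
    exact (edist_add_add_le _ _ _ _).trans (add_le_add ((edist_add_add_le _ _ _ _).trans
      (add_le_add k3 (hmul D _ _ _ k1))) (hmul lam _ _ _ k2))
  · exact (hMu.choose_spec.1.integrable ⟨t, ht⟩).aestronglyMeasurable.aemeasurable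

end StochasticBurgers

theorem theorem2 {Ω : Type*} [MeasurableSpace Ω] (P : Measure Ω) [IsProbabilityMeasure P]
    (D χ lam T : ℝ) (hD : 0 < D) (hχ : 0 < χ) (hT : 0 < T)
    (Y : ℝ → Ω → StochasticBurgers.TempDist)
    (hY : StochasticBurgers.IsStationaryEnergySolution P D χ lam T Y) (u : 𝓢(ℝ, ℝ)) :
    ∀ᵐ ω ∂P, ∀ α : ℝ≥0, 0 < α → α < 1 / 4 →
      ∃ C : ℝ≥0, HolderOnWith C α (fun t => Y t ω u) (Icc 0 T) := by
  have h4 : (0 : ℝ≥0) < 1 / 4 := by norm_num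
  -- The exceptional null set depends on the index, so a sequence increasing to 1/4 is used. On the
  -- bounded interval a larger index implies the smaller ones.
  obtain ⟨a, -, ha, halim⟩ := exists_seq_strictMono_tendsto' h4
  have hall : ∀ᵐ ω ∂P, ∀ n, ∃ C : ℝ≥0, HolderOnWith C (a n) (fun t => Y t ω u) (Icc 0 T) :=
    ae_all_iff.2 fun n => hY.ae_holderOnWith hD hχ hT u (ha n).1 (ha n).2
  filter_upwards [hall] with ω hω α hα hα4
  obtain ⟨n, hn⟩ := (halim.eventually (lt_mem_nhds hα4)).exists
  obtain ⟨C, hC⟩ := hω n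
  refine ⟨_, hC.of_le (D := T.toNNReal) (fun x hx y hy => ?_) hn.le⟩
  rw [edist_dist]
  refine ENNReal.ofReal_le_ofReal ?_
  simpa using Real.dist_le_of_mem_Icc hx hy
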